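/- **Law of large numbers for excited random walk, $d\ge 1$.** Let $d\ge1$, let $\mathcal E=\{\pm e_1,\dots,\pm e_d\}$ be the set of unit coordinate vectors of $\mathbb Z^d$ and let $\mathcal M_{\mathcal E}$ be the set of probability vectors on $\mathcal E$ (cookies). Let $\mathbb P$ be a probability measure on $\Omega=\mathcal M_{\mathcal E}^{\mathbb Z^d\times\mathbb N}$, $\mathbb N=\{1,2,\dots\}$, equipped with the product Borel $\sigma$-algebra, and write $\omega=(\omega(z,e,i))_{z\in\mathbb Z^d,e\in\mathcal E,i\in\mathbb N}\in\Omega$. For $\omega\in\Omega$ let $P_{0,\omega}$ be the law of the nearest-neighbour process $(X_n)_{n\ge0}$ on $\mathbb Z^d$ with $X_0=0$ and $$P_{0,\omega}[X_{n+1}=X_n+e\mid X_0,\dots,X_n]=\omega\bigl(X_n,e,\#\{i\in\{0,\dots,n\}: X_i=X_n\}\bigr)\qquad(n\ge0,\ e\in\mathcal E),$$ and let $P_0$ be the averaged measure: $\omega$ is drawn from $\mathbb P$ and then $(X_n)$ from $P_{0,\omega}$. For $\ell\in\mathbb R^d$ let $A_\ell=\{\lim_{n\to\infty}X_n\cdot\ell=+\infty\}$.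 Assume that the cookie stacks $(\omega(z,\cdot,\cdot))_{z\in\mathbb Z^d}$ are i.i.d. under $\mathbb P$. If $d=1$, assume that $\mathbb P[\forall i\in\mathbb N:\ \omega(z,e,i)>0]>0$ for all $z\in\mathbb Z^d$ and $e\in\mathcal E$; if $d\ge2$, assume that for all $z\in\mathbb Z^d$, $e\in\mathcal E$ and $i\in\mathbb N$, $\omega(z,e,i)>0$ holds $\mathbb P$-a.s. Let $\ell_1,\dots,\ell_d$ be a basis of $\mathbb R^d$ such that $P_0[A_{\ell_i}\cup A_{-\ell_i}]=1$ for all $i=1,\dots,d$. Then there are (non-random) $v\in\mathbb R^d$ and $c\ge0$ such that $P_0$-a.s. the limit $\lim_{n\to\infty}X_n/n$ exists and belongs to $\{v,-cv\}$. If, in addition, $P_0[A_{\ell_i}]=1$ for all $i=1,\dots,d$, then there is a non-random $v\in\mathbb R^d$ with $\lim_{n\to\infty}X_n/n=v$ $P_0$-a.s., and $v\cdot\ell_i\ge0$ for all $i=1,\dots,d$. -/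

import Mathlib

open MeasureTheory ProbabilityTheory Filter Topology
open scoped ENNReal

namespace ERW

/-- Sites of the lattice `ℤ^d`, with its discrete (product) sigma-algebra. -/
abbrev Site (d : ℕ) : Type := Fin d → ℤ

/-- The `2d` unit directions; `(j, s)` stands for the vector `s • e_j`, `s = ±1`. -/
abbrev Dir (d : ℕ) : Type := Fin d × ℤˣ

/-- The unit vector of `ℤ^d` that a direction stands for. -/
def Dir.vec {d : ℕ} (e : Dir d) : Site d := Pi.single e.1 (e.2 : ℤ)

/-- Cookies: probability vectors indexed by the `2d` unit directions, with the Borel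
sigma-algebra inherited from `ℝ^(2d)`. -/
abbrev Cookie (d : ℕ) : Type := stdSimplex ℝ (Dir d)

/-- Cookie environments. The stack at `z` is numbered from `0`: `ω z i` is the cookie which is
eaten on the visit to `z` that is preceded by exactly `i` earlier visits, that is, on the
`(i + 1)`-st visit. The sigma-algebra is the product one. -/
abbrev Env (d : ℕ) : Type := Site d → ℕ → Cookie d

/-- Trajectories `(X_n)_{n ≥ 0}` in `ℤ^d`, with the product sigma-algebra. -/
abbrev Path (d : ℕ) : Type := ℕ → Site d

/-- The law of `x + e` where `e` is chosen according to the cookie `c`. -/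
noncomputable def jump {d : ℕ} (c : Cookie d) (x : Site d) : Measure (Site d) :=
  ∑ e : Dir d, ENNReal.ofReal ((c : Dir d → ℝ) e) • Measure.dirac (x + e.vec)

lemma isProbabilityMeasure_jump {d : ℕ} (c : Cookie d) (x : Site d) :
    IsProbabilityMeasure (jump c x) := by
  constructor
  have h1 : ∑ e, (c : Dir d → ℝ) e = 1 := c.2.2
  have h0 : ∀ e, 0 ≤ (c : Dir d → ℝ) e := c.2.1
  simp [jump, ← ENNReal.ofReal_sum_of_nonneg (fun e _ => h0 e), h1]

/-- Number of visits before time `n` to the position occupied at time `n`, for a path `h`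
known up to time `n`. -/
def priorVisits {d n : ℕ} (h : Finset.Iic n → Site d) : ℕ :=
  (Finset.univ.filter
    (fun i : Finset.Iic n => i.1 < n ∧ h i = h ⟨n, Finset.mem_Iic.2 le_rfl⟩)).card

/-- Law of `X_{n+1}` given `X_0, …, X_n` in the environment `ω`. -/
noncomputable def stepKernel {d : ℕ} (ω : Env d) (n : ℕ) :
    Kernel (Finset.Iic n → Site d) (Site d) where
  toFun h := jump (ω (h ⟨n, Finset.mem_Iic.2 le_rfl⟩) (priorVisits h))
    (h ⟨n, Finset.mem_Iic.2 le_rfl⟩)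
  measurable' := Measurable.of_discrete

instance {d : ℕ} (ω : Env d) (n : ℕ) : IsMarkovKernel (stepKernel ω n) :=
  ⟨fun _ => isProbabilityMeasure_jump _ _⟩

/-- The quenched law of the excited random walk started at `x` in the environment `ω`. -/
noncomputable def quenched {d : ℕ} (x : Site d) (ω : Env d) : Measure (Path d) :=
  Kernel.trajMeasure (X := fun _ => Site d) (Measure.dirac x) (stepKernel ω)

instance {d : ℕ} (x : Site d) (ω : Env d) : IsProbabilityMeasure (quenched x ω) := by
  unfold quenched; infer_instance

lemma quenched_eq_traj {d : ℕ} (x : Site d) (ω : Env d) :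
    quenched x ω = Kernel.traj (X := fun _ => Site d) (stepKernel ω) 0 (fun _ => x) := by
  unfold quenched Kernel.trajMeasure
  have hm : Measurable (MeasurableEquiv.piUnique
      (fun i : Finset.Iic 0 => (fun _ : ℕ => Site d) i)).symm := MeasurableEquiv.measurable _
  have := Measure.map_dirac' hm x
  refine (congrArg (fun m => Measure.bind m
    (Kernel.traj (X := fun _ => Site d) (stepKernel ω) 0)) this).trans ?_
  rw [Measure.dirac_bind (Kernel.measurable _)]
  congr 1

lemma measurable_stepKernel {d : ℕ} (n : ℕ) (h : Finset.Iic n → Site d) (s : Set (Site d)) :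
    Measurable (fun ω : Env d => stepKernel ω n h s) := by
  have : ∀ ω : Env d, stepKernel ω n h s =
      jump (ω (h ⟨n, Finset.mem_Iic.2 le_rfl⟩) (priorVisits h))
        (h ⟨n, Finset.mem_Iic.2 le_rfl⟩) s := fun _ => rfl
  simp only [this, jump, Measure.coe_finsetSum, Finset.sum_apply, Measure.smul_apply,
    smul_eq_mul]
  refine Finset.measurable_sum _ fun e _ => Measurable.mul_const ?_ _
  refine ENNReal.measurable_ofReal.comp ((measurable_pi_apply e).comp
    (measurable_subtype_coe.comp ?_))
  exact (measurable_pi_apply _).comp (measurable_pi_apply _)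

lemma measurable_partialTraj {d : ℕ} (x : Site d) (b : ℕ) (s : Set (Finset.Iic b → Site d)) :
    Measurable (fun ω : Env d =>
      Kernel.partialTraj (X := fun _ => Site d) (stepKernel ω) 0 b (fun _ => x) s) := by
  induction b with
  | zero => simp
  | succ b ih =>
    have hs : MeasurableSet s := .of_discrete
    simp only [Kernel.partialTraj_succ_eq_comp (Nat.zero_le b)]
    simp_rw [Kernel.comp_apply' _ _ _ hs, lintegral_countable']
    refine Measurable.tsum fun h => Measurable.mul ?_ (ih {h})
    simp_rw [Kernel.partialTraj_succ_self]
    have key : ∀ ω : Env d, ((Kernel.id ×ₖ ((stepKernel ω b).map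
        (MeasurableEquiv.piSingleton (X := fun _ => Site d) b))).map
        (IicProdIoc (X := fun _ => Site d) b (b + 1))) h s =
        stepKernel ω b h {y | IicProdIoc (X := fun _ => Site d) b (b + 1)
          (h, MeasurableEquiv.piSingleton (X := fun _ => Site d) b y) ∈ s} := by
      intro ω
      rw [Kernel.map_apply _ (by fun_prop), Kernel.prod_apply,
        Kernel.map_apply _ (MeasurableEquiv.measurable _), Kernel.id_apply, Measure.dirac_prod,
        Measure.map_map (by fun_prop) (by fun_prop),
        Measure.map_map (by fun_prop) (MeasurableEquiv.measurable _),
        Measure.map_apply (.of_discrete) hs]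
      rfl
    simp_rw [key]
    exact measurable_stepKernel b h _

lemma measurable_quenched {d : ℕ} (x : Site d) : Measurable (quenched (d := d) x) := by
  refine Measurable.measure_of_isPiSystem_of_isProbabilityMeasure
    (generateFrom_measurableCylinders (α := fun _ : ℕ => Site d)).symm
    isPiSystem_measurableCylinders ?_
  intro s hs
  obtain ⟨I, S, hS, rfl⟩ := (mem_measurableCylinders _).1 hs
  have key : ∀ ω : Env d, quenched x ω (cylinder I S) =
      Kernel.partialTraj (X := fun _ => Site d) (stepKernel ω) 0 (I.sup id) (fun _ => x)
        (Finset.restrict₂ (π := fun _ => Site d) I.subset_Iic_sup_id ⁻¹' S) := by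
    intro ω
    rw [← Kernel.traj_map_frestrictLe_apply, ← quenched_eq_traj,
      Measure.map_apply (by fun_prop) .of_discrete]
    rfl
  simp_rw [key]
  exact measurable_partialTraj x _ _

/-- The quenched laws, as a kernel from environments to trajectories. -/
noncomputable def quenchedKernel {d : ℕ} (x : Site d) : Kernel (Env d) (Path d) where
  toFun := quenched x
  measurable' := measurable_quenched x

instance {d : ℕ} (x : Site d) : IsMarkovKernel (quenchedKernel (d := d) x) :=
  ⟨fun ω => inferInstanceAs (IsProbabilityMeasure (quenched x ω))⟩

/-- The averaged (annealed) law on environments times trajectories: the environment is drawn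
from `P`, then the walk from its quenched law. -/
noncomputable def averaged {d : ℕ} (P : Measure (Env d)) (x : Site d) :
    Measure (Env d × Path d) :=
  P ⊗ₘ quenchedKernel x

/-- The cookie stacks at the different sites are independent and identically distributed. -/
def IID {d : ℕ} (P : Measure (Env d)) : Prop :=
  iIndepFun (fun (z : Site d) (ω : Env d) => ω z) P ∧
    ∀ z z' : Site d, IdentDistrib (fun ω : Env d => ω z) (fun ω : Env d => ω z') P P

/-- Weak ellipticity. -/
def WEL {d : ℕ} (P : Measure (Env d)) : Prop :=
  ∀ (z : Site d) (e : Dir d), 0 < P {ω | ∀ i : ℕ, 0 < (ω z i : Dir d → ℝ) e}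

/-- Ellipticity. -/
def EL {d : ℕ} (P : Measure (Env d)) : Prop :=
  ∀ (z : Site d) (e : Dir d) (i : ℕ), ∀ᵐ ω ∂P, 0 < (ω z i : Dir d → ℝ) e

/-- A lattice site as a point of Euclidean space `ℝ^d`. -/
noncomputable def toEuclid {d : ℕ} (x : Site d) : EuclideanSpace ℝ (Fin d) :=
  WithLp.toLp 2 (fun j => (x j : ℝ))

/-- The event `A_l` that `X_n · l → ∞`. -/
def transientEvent {d : ℕ} (l : EuclideanSpace ℝ (Fin d)) : Set (Env d × Path d) :=
  {p | Tendsto (fun n : ℕ => inner ℝ (toEuclid (p.2 n)) l) atTop atTop}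

/-- Strong law of large numbers with velocity `v` for the walk started at `0`. -/
def StrongLLN {d : ℕ} (P : Measure (Env d)) (v : EuclideanSpace ℝ (Fin d)) : Prop :=
  ∀ᵐ p ∂(averaged P 0), Tendsto (fun n : ℕ => (n : ℝ)⁻¹ • toEuclid (p.2 n)) atTop (𝓝 v)

end ERW

namespace ERW

variable {d : ℕ}

/-! ### Cylinders of trajectories -/

/-- Trajectories that agree with `h` up to time `n`. -/
def cyl (h : Path d) (n : ℕ) : Set (Path d) := {X | ∀ i ≤ n, X i = h i}

/-- Events decided by the trajectory up to time `n`. -/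
def DeterminedBy (n : ℕ) (E : Set (Path d)) : Prop :=
  ∀ X Y : Path d, (∀ i ≤ n, X i = Y i) → X ∈ E → Y ∈ E

lemma cyl_eq_preimage (h : Path d) (n : ℕ) :
    cyl h n = Preorder.frestrictLe (π := fun _ : ℕ => Site d) n ⁻¹'
      {fun i : Finset.Iic n => h i} := by
  ext X
  constructor
  · intro hX
    exact funext fun i => hX i (Finset.mem_Iic.1 i.2)
  · intro hX i hi
    exact congrFun hX ⟨i, Finset.mem_Iic.2 hi⟩

lemma measurableSet_cyl (h : Path d) (n : ℕ) : MeasurableSet (cyl h n) := by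
  rw [cyl_eq_preimage]
  exact (Preorder.measurable_frestrictLe n) (.of_discrete)

lemma DeterminedBy.eq_preimage {n : ℕ} {E : Set (Path d)} (hE : DeterminedBy n E) :
    E = Preorder.frestrictLe (π := fun _ : ℕ => Site d) n ⁻¹'
      (Preorder.frestrictLe (π := fun _ : ℕ => Site d) n '' E) := by
  refine Set.Subset.antisymm (Set.subset_preimage_image _ _) ?_
  rintro X ⟨Y, hY, hYX⟩
  exact hE Y X (fun i hi => congrFun hYX ⟨i, Finset.mem_Iic.2 hi⟩) hY

lemma DeterminedBy.measurableSet {n : ℕ} {E : Set (Path d)} (hE : DeterminedBy n E) :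
    MeasurableSet E := by
  rw [hE.eq_preimage]
  exact (Preorder.measurable_frestrictLe n) (.of_discrete)

lemma DeterminedBy.mono {n m : ℕ} (hnm : n ≤ m) {E : Set (Path d)} (hE : DeterminedBy n E) :
    DeterminedBy m E := fun X Y h => hE X Y fun i hi => h i (hi.trans hnm)

lemma DeterminedBy.inter {n : ℕ} {E F : Set (Path d)} (hE : DeterminedBy n E)
    (hF : DeterminedBy n F) : DeterminedBy n (E ∩ F) :=
  fun X Y h hX => ⟨hE X Y h hX.1, hF X Y h hX.2⟩

lemma determinedBy_cyl (h : Path d) (n : ℕ) : DeterminedBy n (cyl h n) :=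
  fun _ _ hXY hX i hi => (hXY i hi).symm.trans (hX i hi)

/-- Measures that agree on the cylinders inside a determined event agree on that event. -/
lemma DeterminedBy.measure_eq {μ ν : Measure (Path d)} {n : ℕ} {E : Set (Path d)}
    (hE : DeterminedBy n E) (h : ∀ g ∈ E, μ (cyl g n) = ν (cyl g n)) : μ E = ν E := by
  have hdec : E = ⋃ q ∈ Preorder.frestrictLe (π := fun _ : ℕ => Site d) n '' E,
      Preorder.frestrictLe (π := fun _ : ℕ => Site d) n ⁻¹' {q} := by
    conv_lhs => rw [hE.eq_preimage]
    ext X; simp [eq_comm]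
  have hd : (Preorder.frestrictLe (π := fun _ : ℕ => Site d) n '' E).PairwiseDisjoint
      (fun q => Preorder.frestrictLe (π := fun _ : ℕ => Site d) n ⁻¹' {q}) := by
    intro q _ q' _ hne
    exact (Set.disjoint_singleton.2 hne).preimage _
  rw [hdec, measure_biUnion (Set.to_countable _) hd
      (fun q _ => (Preorder.measurable_frestrictLe n) (.of_discrete)),
    measure_biUnion (Set.to_countable _) hd
      (fun q _ => (Preorder.measurable_frestrictLe n) (.of_discrete))]
  refine tsum_congr ?_
  rintro ⟨q, X, hX, rfl⟩
  have := h X hX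
  rwa [cyl_eq_preimage] at this

lemma ext_of_cyl {μ ν : Measure (Path d)} [IsFiniteMeasure μ]
    (h : ∀ g n, μ (cyl g n) = ν (cyl g n)) : μ = ν := by
  refine ext_of_generate_finite _ (generateFrom_measurableCylinders (α := fun _ : ℕ => Site d)).symm
    isPiSystem_measurableCylinders ?_ ?_
  · intro s hs
    obtain ⟨I, S, hS, rfl⟩ := (mem_measurableCylinders _).1 hs
    have : DeterminedBy (I.sup id) (cylinder (α := fun _ : ℕ => Site d) I S) := by
      intro X Y hXY hX
      have : I.restrict (π := fun _ : ℕ => Site d) X = I.restrict (π := fun _ : ℕ => Site d) Y := by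
        ext1 i
        exact hXY i (Finset.le_sup (f := id) i.2)
      simpa only [mem_cylinder, this] using hX
    exact this.measure_eq fun g _ => h g _
  · have : DeterminedBy (d := d) 0 Set.univ := fun _ _ _ _ => trivial
    exact this.measure_eq fun g _ => h g _

/-- If an event of positive measure is covered by countably many events indexed by times, then some
cylinder meets one of these events in positive measure. -/
lemma exists_cyl_pos {μ : Measure (Path d)} {A : Set (Path d)} (hA : μ A ≠ 0)
    {B : ℕ → Set (Path d)} (hAB : A ⊆ ⋃ n, B n) :
    ∃ n, ∃ h ∈ B n, μ (cyl h n ∩ B n) ≠ 0 := by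
  by_contra! hcon
  refine hA (measure_mono_null hAB (measure_iUnion_null fun n => ?_))
  have hdec : B n ⊆ ⋃ q ∈ Preorder.frestrictLe (π := fun _ : ℕ => Site d) n '' B n,
      (Preorder.frestrictLe (π := fun _ : ℕ => Site d) n ⁻¹' {q} ∩ B n) := by
    intro X hX
    simp only [Set.mem_iUnion]
    exact ⟨_, ⟨X, hX, rfl⟩, rfl, hX⟩
  refine measure_mono_null hdec ((measure_biUnion_null_iff (Set.to_countable _)).2 ?_)
  rintro q ⟨X, hX, rfl⟩
  have := hcon n X hX
  rwa [cyl_eq_preimage] at this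

/-! ### Quenched cylinder probabilities -/

/-- Number of visits of `h` to `z` before time `n`. -/
def visits (h : Path d) (n : ℕ) (z : Site d) : ℕ := ((Finset.range n).filter (h · = z)).card

/-- Probability of following `h` for `n` steps in the environment `ω`. -/
noncomputable def pathWeight (ω : Env d) (h : Path d) (n : ℕ) : ℝ≥0∞ :=
  ∏ m ∈ Finset.range n, jump (ω (h m) (visits h m (h m))) (h m) {h (m + 1)}

lemma priorVisits_restrict (h : Path d) (n : ℕ) :
    priorVisits (fun i : Finset.Iic n => h i) = visits h n (h n) := by
  unfold priorVisits visits
  refine Finset.card_bij (fun i _ => i.1) ?_ ?_ ?_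
  · intro i hi
    simpa using hi
  · intro i _ j _ hij
    exact Subtype.ext hij
  · intro m hm
    simp only [Finset.mem_filter, Finset.mem_range] at hm
    exact ⟨⟨m, Finset.mem_Iic.2 hm.1.le⟩, by simp [hm.1, hm.2], rfl⟩

lemma partialTraj_succ_singleton (ω : Env d) (x h : Path d) (n : ℕ) :
    Kernel.partialTraj (X := fun _ => Site d) (stepKernel ω) 0 (n + 1) (fun i => x i)
      {fun i : Finset.Iic (n + 1) => h i} =
    Kernel.partialTraj (X := fun _ => Site d) (stepKernel ω) 0 n (fun i => x i)
      {fun i : Finset.Iic n => h i} *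
      jump (ω (h n) (visits h n (h n))) (h n) {h (n + 1)} := by
  have hs : ∀ {k : ℕ} (s : Set (Finset.Iic k → Site d)), MeasurableSet s := fun s => .of_discrete
  rw [Kernel.partialTraj_succ_eq_comp (Nat.zero_le n), Kernel.comp_apply' _ _ _ (hs _),
    lintegral_countable', Kernel.partialTraj_succ_self]
  have key : ∀ g : Finset.Iic n → Site d, ((Kernel.id ×ₖ ((stepKernel ω n).map
      (MeasurableEquiv.piSingleton (X := fun _ => Site d) n))).map
      (IicProdIoc (X := fun _ => Site d) n (n + 1))) g {fun i : Finset.Iic (n + 1) => h i} =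
      stepKernel ω n g {y | IicProdIoc (X := fun _ => Site d) n (n + 1)
        (g, MeasurableEquiv.piSingleton (X := fun _ => Site d) n y) = fun i : Finset.Iic (n + 1) => h i} := by
    intro g
    rw [Kernel.map_apply _ (by fun_prop), Kernel.prod_apply,
      Kernel.map_apply _ (MeasurableEquiv.measurable _), Kernel.id_apply, Measure.dirac_prod,
      Measure.map_map (by fun_prop) (by fun_prop),
      Measure.map_map (by fun_prop) (MeasurableEquiv.measurable _),
      Measure.map_apply (.of_discrete) (hs _)]
    rfl
  simp_rw [key]
  rw [tsum_eq_single (fun i : Finset.Iic n => h i)]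
  · rw [mul_comm]
    congr 1
    have : {y : Site d | IicProdIoc (X := fun _ => Site d) n (n + 1)
        ((fun i : Finset.Iic n => h i), MeasurableEquiv.piSingleton (X := fun _ => Site d) n y) =
          fun i : Finset.Iic (n + 1) => h i} = {h (n + 1)} := by
      ext y
      rw [Set.mem_ofPred_eq, Set.mem_singleton_iff]
      constructor
      · intro hy
        have := congrFun hy ⟨n + 1, Finset.mem_Iic.2 le_rfl⟩
        simpa [IicProdIoc, MeasurableEquiv.piSingleton] using this
      · rintro rfl
        funext ⟨i, hi⟩
        rw [Finset.mem_Iic] at hi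
        by_cases hin : i ≤ n
        · simp [IicProdIoc, hin]
        · obtain rfl : i = n + 1 := by omega
          simp [IicProdIoc, MeasurableEquiv.piSingleton]
    rw [this]
    change jump (ω (h n) (priorVisits fun i : Finset.Iic n => h i)) (h n) _ = _
    rw [priorVisits_restrict]
  · intro g hg
    have : {y : Site d | IicProdIoc (X := fun _ => Site d) n (n + 1)
        (g, MeasurableEquiv.piSingleton (X := fun _ => Site d) n y) = fun i : Finset.Iic (n + 1) => h i} = ∅ := by
      rw [Set.eq_empty_iff_forall_notMem]
      intro y hy
      apply hg
      ext1 i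
      have hi := Finset.mem_Iic.1 i.2
      have := congrFun hy ⟨i, Finset.mem_Iic.2 (hi.trans n.le_succ)⟩
      simpa [IicProdIoc, hi] using this
    simp [this]

lemma quenched_cyl (x : Site d) (ω : Env d) (h : Path d) (n : ℕ) :
    quenched x ω (cyl h n) = if h 0 = x then pathWeight ω h n else 0 := by
  have h1 : ∀ n, quenched x ω (cyl h n) = Kernel.partialTraj (X := fun _ => Site d) (stepKernel ω)
      0 n (fun _ => x) {fun i : Finset.Iic n => h i} := by
    intro n
    rw [quenched_eq_traj, cyl_eq_preimage, ← Kernel.traj_map_frestrictLe_apply,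
      Measure.map_apply (by fun_prop) .of_discrete]
  rw [h1]
  induction n with
  | zero =>
    rw [Kernel.partialTraj_self, Kernel.id_apply, Measure.dirac_apply' _ .of_discrete]
    by_cases hx : h 0 = x
    · have : (fun _ : Finset.Iic 0 => x) = fun i : Finset.Iic 0 => h i := by
        ext1 i
        rw [Nat.le_zero.1 (Finset.mem_Iic.1 i.2), hx]
      simp only [if_pos hx, pathWeight, Finset.range_zero, Finset.prod_empty]
      rw [this]; simp
    · have : (fun _ : Finset.Iic 0 => x) ≠ fun i : Finset.Iic 0 => h i := fun hh =>
        hx (congrFun hh ⟨0, Finset.mem_Iic.2 le_rfl⟩).symm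
      rw [if_neg hx]
      simp only [Set.indicator_apply, Set.mem_singleton_iff, Pi.one_apply, ite_eq_right_iff,
        one_ne_zero, imp_false]
      exact this
  | succ n ih =>
    rw [partialTraj_succ_singleton ω (fun _ => x) h n, ih, ite_mul, zero_mul]
    simp only [pathWeight, Finset.prod_range_succ]

/-! ### The walk after a finite path -/

/-- The trajectory after time `n`, recentred. -/
def post (n : ℕ) (X : Path d) : Path d := fun k => X (n + k) - X n

/-- The environment seen from the end of the path `h` of length `n`, with the cookies already eaten
removed. -/
def after (ω : Env d) (h : Path d) (n : ℕ) : Env d :=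
  fun z i => ω (z + h n) (visits h n (z + h n) + i)

/-- The path `h` up to time `n`, continued by the increments of `g`. -/
def concat (h : Path d) (n : ℕ) (g : Path d) : Path d :=
  fun i => if i ≤ n then h i else h n + g (i - n)

lemma measurable_post (n : ℕ) : Measurable (post (d := d) n) := by
  unfold post; fun_prop

lemma post_post (m n : ℕ) (X : Path d) : post n (post m X) = post (m + n) X := by
  funext k
  simp [post, add_assoc]

lemma concat_add (h g : Path d) (n : ℕ) (hg : g 0 = 0) (m : ℕ) :
    concat h n g (n + m) = h n + g m := by
  rcases Nat.eq_zero_or_pos m with rfl | hm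
  · simp [concat, hg]
  · simp [concat, hm.ne']

lemma concat_of_le (h g : Path d) {n m : ℕ} (hm : m ≤ n) : concat h n g m = h m := by
  simp [concat, hm]

lemma cyl_inter_post (h g : Path d) (n k : ℕ) (hg : g 0 = 0) :
    cyl h n ∩ post n ⁻¹' cyl g k = cyl (concat h n g) (n + k) := by
  ext X
  simp only [cyl, post, Set.mem_inter_iff, Set.mem_ofPred_eq, Set.mem_preimage]
  constructor
  · rintro ⟨h1, h2⟩ i hi
    rcases le_total i n with hin | hin
    · rw [concat_of_le _ _ hin, h1 i hin]
    · obtain ⟨m, rfl⟩ := Nat.exists_eq_add_of_le hin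
      rw [concat_add _ _ _ hg, ← h2 m (by omega), h1 n le_rfl]
      abel
  · intro hX
    have h1 : ∀ i ≤ n, X i = h i := fun i hi => by
      rw [hX i (by omega), concat_of_le _ _ hi]
    refine ⟨h1, fun m hm => ?_⟩
    rw [hX (n + m) (by omega), h1 n le_rfl, concat_add _ _ _ hg]
    abel

lemma visits_concat_of_le (h g : Path d) {n m : ℕ} (hm : m ≤ n) (z : Site d) :
    visits (concat h n g) m z = visits h m z := by
  unfold visits
  congr 1
  refine Finset.filter_congr fun i hi => ?_
  rw [concat_of_le _ _ ((Finset.mem_range.1 hi).le.trans hm)]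

lemma visits_succ (h : Path d) (n : ℕ) (z : Site d) :
    visits h (n + 1) z = visits h n z + if h n = z then 1 else 0 := by
  unfold visits
  rw [Finset.range_add_one, Finset.filter_insert]
  split_ifs with hz
  · rw [Finset.card_insert_of_notMem (by simp)]
  · rfl

lemma visits_concat_add (h g : Path d) (n m : ℕ) (hg : g 0 = 0) (z : Site d) :
    visits (concat h n g) (n + m) (z + h n) = visits h n (z + h n) + visits g m z := by
  induction m with
  | zero =>
    rw [add_zero, visits_concat_of_le _ _ le_rfl]
    simp [visits]
  | succ m ih =>
    rw [← add_assoc, visits_succ, ih, visits_succ, concat_add _ _ _ hg, add_assoc]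
    congr 2
    simp [add_comm (h n)]

lemma jump_add (c : Cookie d) (x y z : Site d) : jump c (x + z) {y + z} = jump c x {y} := by
  simp only [jump, Measure.coe_finsetSum, Finset.sum_apply, Measure.smul_apply, smul_eq_mul]
  refine Finset.sum_congr rfl fun e _ => ?_
  rw [Measure.dirac_apply' _ .of_discrete, Measure.dirac_apply' _ .of_discrete]
  simp only [Set.indicator_apply, Set.mem_singleton_iff]
  congr 2
  rw [add_right_comm]; simp

lemma pathWeight_concat (ω : Env d) (h g : Path d) (n k : ℕ) (hg : g 0 = 0) :
    pathWeight ω (concat h n g) (n + k) = pathWeight ω h n * pathWeight (after ω h n) g k := by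
  unfold pathWeight
  rw [Finset.prod_range_add]
  congr 1
  · refine Finset.prod_congr rfl fun m hm => ?_
    have hm' := Finset.mem_range.1 hm
    rw [concat_of_le _ _ hm'.le, concat_of_le _ _ (Nat.succ_le_of_lt hm'),
      visits_concat_of_le _ _ hm'.le]
  · refine Finset.prod_congr rfl fun m _ => ?_
    rw [add_assoc, concat_add _ _ _ hg, concat_add _ _ _ hg, add_comm (h n), add_comm (h n),
      visits_concat_add _ _ _ _ hg, jump_add]
    rfl

/-- Markov property of the quenched walk at a deterministic time. -/
lemma quenched_cyl_inter_post (ω : Env d) (h : Path d) (n : ℕ) {B : Set (Path d)}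
    (hB : MeasurableSet B) :
    quenched 0 ω (cyl h n ∩ post n ⁻¹' B) =
      quenched 0 ω (cyl h n) * quenched 0 (after ω h n) B := by
  have hfin : quenched 0 ω (cyl h n) ≠ ∞ := measure_ne_top _ _
  have : IsFiniteMeasure (quenched 0 ω (cyl h n) • quenched 0 (after ω h n)) :=
    Measure.smul_finite _ hfin
  have key : quenched 0 ω (cyl h n) • quenched 0 (after ω h n) =
      ((quenched 0 ω).restrict (cyl h n)).map (post n) := by
    refine ext_of_cyl fun g k => ?_
    rw [Measure.map_apply (measurable_post n) (measurableSet_cyl g k),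
      Measure.restrict_apply (measurable_post n (measurableSet_cyl g k)), Set.inter_comm,
      Measure.smul_apply, smul_eq_mul, quenched_cyl 0 (after ω h n)]
    by_cases hg : g 0 = 0
    · rw [cyl_inter_post _ _ _ _ hg, quenched_cyl, quenched_cyl, if_pos hg,
        concat_of_le _ _ (Nat.zero_le n), pathWeight_concat _ _ _ _ _ hg, ite_mul, zero_mul]
    · have : cyl h n ∩ post n ⁻¹' cyl g k = ∅ := by
        rw [Set.eq_empty_iff_forall_notMem]
        rintro X ⟨_, hX⟩
        exact hg (by rw [← hX 0 (Nat.zero_le k)]; simp [post])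
      rw [this, if_neg hg]
      simp
  rw [← smul_eq_mul, ← Measure.smul_apply, key, Measure.map_apply (measurable_post n) hB,
    Measure.restrict_apply (measurable_post n hB), Set.inter_comm]

lemma pathWeight_congr {ω ω' : Env d} {h : Path d} {n : ℕ}
    (H : ∀ m < n, ω (h m) = ω' (h m)) : pathWeight ω h n = pathWeight ω' h n :=
  Finset.prod_congr rfl fun m hm => by rw [H m (Finset.mem_range.1 hm)]

/-- An event on which the walk stays in `S` has a probability which depends only on the stacks
in `S`. -/
lemma quenched_congr {ω ω' : Env d} {S : Set (Site d)} (hS : ∀ z ∈ S, ω z = ω' z)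
    {A : Set (Path d)} (hAS : ∀ X ∈ A, ∀ m, X m ∈ S) :
    quenched 0 ω A = quenched 0 ω' A := by
  set T : ℕ → Set (Path d) := fun k => {X | ∀ m ≤ k, X m ∈ S} with hT
  have hTdet : ∀ k, DeterminedBy k (T k) := fun k X Y hXY hX m hm => hXY m hm ▸ hX m hm
  have hTanti : Antitone T := fun a b hab X hX m hm => hX m (hm.trans hab)
  have key : ∀ k (g : Path d) (n : ℕ),
      quenched 0 ω (T (k + n) ∩ cyl g n) = quenched 0 ω' (T (k + n) ∩ cyl g n) := by
    intro k g n
    refine ((hTdet (k + n)).inter ((determinedBy_cyl g n).mono (by omega))).measure_eq ?_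
    intro X hX
    rw [quenched_cyl, quenched_cyl, pathWeight_congr fun m hm => hS _ (hX.1 m hm.le)]
  have hlim : ∀ (ν : Measure (Path d)) [IsFiniteMeasure ν] (g : Path d) (n : ℕ),
      Tendsto (fun k => ν (T (k + n) ∩ cyl g n)) atTop (𝓝 (ν (⋂ k, (T (k + n) ∩ cyl g n)))) := by
    intro ν _ g n
    refine tendsto_measure_iInter_atTop (fun k => ((hTdet _).measurableSet.inter
      (measurableSet_cyl g n)).nullMeasurableSet) ?_ ⟨0, measure_ne_top _ _⟩
    exact fun a b hab => Set.inter_subset_inter_left _ (hTanti (by omega))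
  have hI : ∀ n (g : Path d), ⋂ k, (T (k + n) ∩ cyl g n) = cyl g n ∩ ⋂ k, T k := by
    intro n g
    ext X
    simp only [Set.mem_iInter, Set.mem_inter_iff]
    constructor
    · intro h
      exact ⟨(h 0).2, fun k => hTanti (Nat.le_add_right k n) (h k).1⟩
    · rintro ⟨h1, h2⟩ k
      exact ⟨h2 _, h1⟩
  have hmeas : MeasurableSet (⋂ k, T k) := .iInter fun k => (hTdet k).measurableSet
  have hres : (quenched 0 ω).restrict (⋂ k, T k) = (quenched 0 ω').restrict (⋂ k, T k) := by
    refine ext_of_cyl fun g n => ?_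
    rw [Measure.restrict_apply (measurableSet_cyl g n),
      Measure.restrict_apply (measurableSet_cyl g n), ← hI]
    refine tendsto_nhds_unique (hlim (quenched 0 ω) g n) ?_
    simp_rw [key]
    exact hlim (quenched 0 ω') g n
  have hsub : A ⊆ ⋂ k, T k := fun X hX => Set.mem_iInter.2 fun k m _ => hAS X hX m
  rw [← Measure.restrict_eq_self _ hsub, hres, Measure.restrict_eq_self _ hsub]

/-! ### Independence and stationarity of the environment -/

/-- The environment seen from `x`. -/
def shiftEnv (x : Site d) (ω : Env d) : Env d := fun z => ω (z + x)

lemma measurable_shiftEnv (x : Site d) : Measurable (shiftEnv (d := d) x) := by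
  unfold shiftEnv; fun_prop

lemma IID.map_shiftEnv {P : Measure (Env d)} [IsProbabilityMeasure P] (hP : IID P) (x : Site d) :
    P.map (shiftEnv x) = P := by
  have hm : ∀ z : Site d, Measurable fun ω : Env d => ω z := fun z => measurable_pi_apply z
  have hpm : ∀ z : Site d, IsProbabilityMeasure (P.map fun ω : Env d => ω z) :=
    fun z => Measure.isProbabilityMeasure_map (hm z).aemeasurable
  have h1 : P = Measure.infinitePi fun z : Site d => P.map fun ω : Env d => ω z := by
    have := hP.1.map_fun_eq_infinitePi_map hm
    rwa [show (fun (ω : Env d) (i : Site d) => ω i) = id from rfl, Measure.map_id] at this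
  conv_lhs => rw [h1]
  have h2 := Measure.map_infinitePi_infinitePi_of_inj
    (P := fun z : Site d => P.map fun ω : Env d => ω z) (f := fun z : Site d => z + x)
    (add_left_injective x)
  refine h2.trans ?_
  conv_rhs => rw [h1]
  congr 1
  funext z
  exact (hP.2 (z + x) z).map_eq

lemma IID.indepFun_restrict {P : Measure (Env d)} (hP : IID P) (S : Set (Site d)) :
    IndepFun (fun (ω : Env d) (z : S) => ω z) (fun (ω : Env d) (z : (Sᶜ : Set (Site d))) => ω z)
      P := by
  have h := indep_iSup_of_disjoint (S := S) (T := Sᶜ)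
    (m := fun z : Site d => MeasurableSpace.comap (fun ω : Env d => ω z) inferInstance)
    (fun z => (measurable_pi_apply z).comap_le) hP.1 disjoint_compl_right
  have key : ∀ T : Set (Site d), MeasurableSpace.comap (fun (ω : Env d) (z : T) => ω z)
      inferInstance ≤ ⨆ z ∈ T, MeasurableSpace.comap (fun ω : Env d => ω z) inferInstance := by
    intro T
    rw [← measurable_iff_comap_le]
    refine @measurable_pi_lambda _ _ _ (_) _ _ fun z => ?_
    refine Measurable.of_comap_le ?_
    exact le_iSup₂ (f := fun (z : Site d) (_ : z ∈ T) =>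
      MeasurableSpace.comap (fun ω : Env d => ω z) inferInstance) z.1 z.2
  exact indep_of_indep_of_le_left (indep_of_indep_of_le_right h (key _)) (key _)

/-- Functions that depend on disjoint parts of the environment are independent. -/
lemma IID.indepFun {P : Measure (Env d)} [IsProbabilityMeasure P] (hP : IID P) (S : Set (Site d))
    {f g : Env d → ℝ≥0∞} (hf : Measurable f) (hg : Measurable g)
    (hfS : ∀ ω ω' : Env d, (∀ z ∈ S, ω z = ω' z) → f ω = f ω')
    (hgS : ∀ ω ω' : Env d, (∀ z ∉ S, ω z = ω' z) → g ω = g ω') : IndepFun f g P := by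
  classical
  obtain ⟨ω₀⟩ := nonempty_of_isProbabilityMeasure P
  have hext : ∀ T : Set (Site d), Measurable (fun (η : T → ℕ → Cookie d) (z : Site d) =>
      if hz : z ∈ T then η ⟨z, hz⟩ else ω₀ z) := by
    intro T
    refine measurable_pi_lambda _ fun z => ?_
    by_cases hz : z ∈ T
    · simp only [hz, dif_pos]; fun_prop
    · simp only [hz, dif_neg, not_false_eq_true]; fun_prop
  have h := (hP.indepFun_restrict S).comp (hf.comp (hext S)) (hg.comp (hext Sᶜ))
  convert h using 1
  · funext ω
    exact hfS _ _ fun z hz => by simp [hz]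
  · funext ω
    exact hgS _ _ fun z hz => by simp [hz]

lemma measurable_quenched_apply (x : Site d) {A : Set (Path d)} (hA : MeasurableSet A) :
    Measurable fun ω : Env d => quenched x ω A :=
  (Measure.measurable_coe hA).comp (measurable_quenched x)

/-! ### The annealed law of the walk -/

/-- Law of the walk from the origin in a random environment. -/
noncomputable def annealed (P : Measure (Env d)) : Measure (Path d) := P.bind (quenched 0)

lemma annealed_apply (P : Measure (Env d)) {A : Set (Path d)} (hA : MeasurableSet A) :
    annealed P A = ∫⁻ ω, quenched 0 ω A ∂P :=
  Measure.bind_apply hA (measurable_quenched 0).aemeasurable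

lemma map_snd_averaged (P : Measure (Env d)) [IsProbabilityMeasure P] :
    (averaged P 0).map Prod.snd = annealed P := Measure.snd_compProd P (quenchedKernel 0)

instance (P : Measure (Env d)) [IsProbabilityMeasure P] : IsProbabilityMeasure (averaged P 0) := by
  unfold averaged; infer_instance

instance (P : Measure (Env d)) [IsProbabilityMeasure P] : IsProbabilityMeasure (annealed P) := by
  rw [← map_snd_averaged]
  exact Measure.isProbabilityMeasure_map measurable_snd.aemeasurable

lemma annealed_eq_zero_iff (P : Measure (Env d)) {A : Set (Path d)} (hA : MeasurableSet A) :
    annealed P A = 0 ↔ ∀ᵐ ω ∂P, quenched 0 ω A = 0 := by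
  rw [annealed_apply P hA, lintegral_eq_zero_iff (measurable_quenched_apply 0 hA)]
  rfl

lemma visits_eq_zero {h : Path d} {n : ℕ} {z : Site d} (hz : ∀ m < n, h m ≠ z) :
    visits h n z = 0 := by
  rw [visits, Finset.card_eq_zero, Finset.filter_eq_empty_iff]
  exact fun m hm => hz m (Finset.mem_range.1 hm)

lemma after_eq_shiftEnv {ω : Env d} {h : Path d} {n : ℕ} {z : Site d}
    (hz : ∀ m < n, h m - h n ≠ z) : after ω h n z = shiftEnv (h n) ω z := by
  have : visits h n (z + h n) = 0 :=
    visits_eq_zero fun m hm hmz => hz m hm (by rw [hmz, add_sub_cancel_right])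
  funext i
  simp [after, shiftEnv, this]

lemma IID.lintegral_shiftEnv {P : Measure (Env d)} [IsProbabilityMeasure P] (hP : IID P)
    (x : Site d) {f : Env d → ℝ≥0∞} (hf : Measurable f) :
    ∫⁻ ω, f (shiftEnv x ω) ∂P = ∫⁻ ω, f ω ∂P := by
  rw [← lintegral_map hf (measurable_shiftEnv x), hP.map_shiftEnv]

/-- After a path which does not meet `S` (seen from its endpoint), the walk is independent of this
path as long as it stays in `S`. -/
lemma annealed_cyl_inter_post {P : Measure (Env d)} [IsProbabilityMeasure P] (hP : IID P)
    {h : Path d} {n : ℕ} {S : Set (Site d)} (hh : ∀ m < n, h m - h n ∉ S) {A : Set (Path d)}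
    (hA : MeasurableSet A) (hAS : ∀ X ∈ A, ∀ m, X m ∈ S) :
    annealed P (cyl h n ∩ post n ⁻¹' A) = annealed P (cyl h n) * annealed P A := by
  have h1 : ∀ ω : Env d, quenched 0 ω (cyl h n ∩ post n ⁻¹' A) =
      quenched 0 ω (cyl h n) * quenched 0 (shiftEnv (h n) ω) A := by
    intro ω
    have hz : ∀ z ∈ S, after ω h n z = shiftEnv (h n) ω z := fun z hz =>
      after_eq_shiftEnv fun m hm hmz => hh m hm (hmz ▸ hz)
    rw [quenched_cyl_inter_post ω h n hA, quenched_congr hz hAS]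
  have hm1 := measurable_quenched_apply (0 : Site d) (measurableSet_cyl h n)
  have hm2 : Measurable fun ω : Env d => quenched 0 (shiftEnv (h n) ω) A :=
    (measurable_quenched_apply (0 : Site d) hA).comp (measurable_shiftEnv (h n))
  have hind : IndepFun (fun ω : Env d => quenched 0 ω (cyl h n))
      (fun ω : Env d => quenched 0 (shiftEnv (h n) ω) A) P := by
    refine hP.indepFun {z | z - h n ∉ S} hm1 hm2 ?_ ?_
    · intro ω ω' H
      rw [quenched_cyl, quenched_cyl, pathWeight_congr fun m hm => H _ (hh m hm)]
    · intro ω ω' H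
      exact quenched_congr (S := S) (fun z hz => H _ (by simpa using hz)) hAS
  calc annealed P (cyl h n ∩ post n ⁻¹' A)
      = ∫⁻ ω, quenched 0 ω (cyl h n) * quenched 0 (shiftEnv (h n) ω) A ∂P := by
        rw [annealed_apply P ((measurableSet_cyl h n).inter (measurable_post n hA))]
        exact lintegral_congr h1
    _ = (∫⁻ ω, quenched 0 ω (cyl h n) ∂P) * ∫⁻ ω, quenched 0 (shiftEnv (h n) ω) A ∂P :=
        lintegral_mul_eq_lintegral_mul_lintegral_of_indepFun hm1 hm2 hind
    _ = annealed P (cyl h n) * annealed P A := by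
        rw [hP.lintegral_shiftEnv (h n) (measurable_quenched_apply 0 hA), annealed_apply P hA,
          annealed_apply P (measurableSet_cyl h n)]

/-- Version of `annealed_cyl_inter_post` for events that are decided at time `n`. -/
lemma annealed_inter_post {P : Measure (Env d)} [IsProbabilityMeasure P] (hP : IID P)
    {n : ℕ} {E : Set (Path d)} (hE : DeterminedBy n E) {S : Set (Site d)}
    (hES : ∀ h ∈ E, ∀ m < n, h m - h n ∉ S) {A : Set (Path d)}
    (hA : MeasurableSet A) (hAS : ∀ X ∈ A, ∀ m, X m ∈ S) :
    annealed P (E ∩ post n ⁻¹' A) = annealed P E * annealed P A := by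
  rw [← Measure.restrict_apply hE.measurableSet, mul_comm, ← smul_eq_mul, ← Measure.smul_apply]
  refine hE.measure_eq fun g hg => ?_
  rw [Measure.restrict_apply (measurableSet_cyl g n),
    annealed_cyl_inter_post hP (hES g hg) hA hAS, mul_comm, Measure.smul_apply, smul_eq_mul]

lemma jump_singleton_eq_zero {c : Cookie d} {x y : Site d} (h : ∀ e : Dir d, y ≠ x + e.vec) :
    jump c x {y} = 0 := by
  simp only [jump, Measure.coe_finsetSum, Finset.sum_apply, Measure.smul_apply, smul_eq_mul]
  refine Finset.sum_eq_zero fun e _ => ?_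
  rw [Measure.dirac_apply' _ .of_discrete, Set.indicator_of_notMem (by simpa using (h e).symm),
    mul_zero]

lemma jump_singleton_pos {c : Cookie d} (x : Site d) {e : Dir d} (h : 0 < (c : Dir d → ℝ) e) :
    jump c x {x + e.vec} ≠ 0 := by
  set y := x + e.vec with hy
  simp only [jump, Measure.coe_finsetSum, Finset.sum_apply, Measure.smul_apply, smul_eq_mul]
  refine ((lt_of_lt_of_le (ENNReal.ofReal_pos.2 h) ?_).ne')
  refine le_trans ?_ (Finset.single_le_sum (f := fun e : Dir d =>
    ENNReal.ofReal ((c : Dir d → ℝ) e) * (Measure.dirac (x + e.vec)) {y})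
    (fun _ _ => zero_le) (Finset.mem_univ e))
  simp [hy]

/-- Nearest-neighbour trajectories from the origin. -/
def nnPaths (d : ℕ) : Set (Path d) := {X | X 0 = 0 ∧ ∀ n, ∃ e : Dir d, X (n + 1) = X n + e.vec}

lemma quenched_nnPaths (ω : Env d) : ∀ᵐ X ∂(quenched 0 ω), X ∈ nnPaths d := by
  have h0 : quenched 0 ω {X : Path d | X 0 = 0}ᶜ = 0 := by
    have : DeterminedBy (d := d) 0 {X : Path d | X 0 = 0}ᶜ := fun X Y h hX hY =>
      hX ((h 0 le_rfl).trans hY)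
    rw [this.measure_eq (ν := 0), Measure.coe_zero, Pi.zero_apply]
    intro g hg
    rw [quenched_cyl, if_neg (show ¬ g 0 = 0 from hg)]; rfl
  have h1 : ∀ n, quenched 0 ω {X : Path d | ∃ e : Dir d, X (n + 1) = X n + e.vec}ᶜ = 0 := by
    intro n
    have : DeterminedBy (d := d) (n + 1) {X : Path d | ∃ e : Dir d, X (n + 1) = X n + e.vec}ᶜ := by
      intro X Y h hX hY
      apply hX
      simpa only [Set.mem_ofPred_eq, h (n + 1) le_rfl, h n n.le_succ] using hY
    rw [this.measure_eq (ν := 0), Measure.coe_zero, Pi.zero_apply]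
    intro g hg
    have hz : jump (ω (g n) (visits g n (g n))) (g n) {g (n + 1)} = 0 :=
      jump_singleton_eq_zero fun e he => hg ⟨e, he⟩
    rw [quenched_cyl, pathWeight, Finset.prod_range_succ, hz, mul_zero, ite_self]; rfl
  have h0' : ∀ᵐ X ∂(quenched 0 ω), X 0 = 0 := h0
  have h1' : ∀ᵐ X ∂(quenched 0 ω), ∀ n, ∃ e : Dir d, X (n + 1) = X n + e.vec := ae_all_iff.2 h1
  filter_upwards [h0', h1'] with X hX hX'
  exact ⟨hX, hX'⟩

lemma measurableSet_nnPaths : MeasurableSet (nnPaths d) := by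
  have : nnPaths d = {X | X 0 = 0} ∩ ⋂ n, ⋃ e : Dir d, {X | X (n + 1) = X n + e.vec} := by
    ext X; simp [nnPaths]
  rw [this]
  refine (measurableSet_eq_fun (by fun_prop) (by fun_prop)).inter (.iInter fun n => .iUnion fun e =>
    measurableSet_eq_fun (by fun_prop) (by fun_prop))

lemma annealed_nnPaths (P : Measure (Env d)) : ∀ᵐ X ∂(annealed P), X ∈ nnPaths d :=
  (annealed_eq_zero_iff P measurableSet_nnPaths.compl).2 (ae_of_all _ quenched_nnPaths)

/-! ### Heights -/

/-- Height of a site in direction `l`. -/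
noncomputable def ht (l : EuclideanSpace ℝ (Fin d)) (z : Site d) : ℝ := inner ℝ (toEuclid z) l

lemma toEuclid_add (x y : Site d) : toEuclid (x + y) = toEuclid x + toEuclid y := by
  ext j; simp [toEuclid]

lemma toEuclid_sub (x y : Site d) : toEuclid (x - y) = toEuclid x - toEuclid y := by
  ext j; simp [toEuclid]

lemma toEuclid_zero : toEuclid (0 : Site d) = 0 := by
  ext j; simp [toEuclid]

lemma ht_add (l : EuclideanSpace ℝ (Fin d)) (x y : Site d) : ht l (x + y) = ht l x + ht l y := by
  rw [ht, toEuclid_add, inner_add_left]; rfl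

lemma ht_sub (l : EuclideanSpace ℝ (Fin d)) (x y : Site d) : ht l (x - y) = ht l x - ht l y := by
  rw [ht, toEuclid_sub, inner_sub_left]; rfl

lemma ht_zero (l : EuclideanSpace ℝ (Fin d)) : ht l 0 = 0 := by
  rw [ht, toEuclid_zero, inner_zero_left]

/-- The trajectories that are transient in direction `l`. -/
def transient (l : EuclideanSpace ℝ (Fin d)) : Set (Path d) :=
  {X | Tendsto (fun n => ht l (X n)) atTop atTop}

/-- The trajectories that never go below height `0`. -/
def nonneg (l : EuclideanSpace ℝ (Fin d)) : Set (Path d) := {X | ∀ n, 0 ≤ ht l (X n)}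

lemma measurable_ht_apply (l : EuclideanSpace ℝ (Fin d)) (n : ℕ) :
    Measurable fun X : Path d => ht l (X n) :=
  (Measurable.of_discrete (f := ht l)).comp (measurable_pi_apply n)

lemma measurableSet_transient (l : EuclideanSpace ℝ (Fin d)) : MeasurableSet (transient l) :=
  measurableSet_tendsto _ fun n => measurable_ht_apply l n

lemma measurableSet_nonneg (l : EuclideanSpace ℝ (Fin d)) : MeasurableSet (nonneg l) := by
  have : nonneg l = ⋂ n, {X : Path d | 0 ≤ ht l (X n)} := by ext; simp [nonneg]
  rw [this]
  exact .iInter fun n => measurableSet_le measurable_const (measurable_ht_apply l n)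

lemma post_mem_transient {l : EuclideanSpace ℝ (Fin d)} {X : Path d} {n : ℕ} :
    post n X ∈ transient l ↔ X ∈ transient l := by
  simp only [transient, Set.mem_ofPred_eq, post, ht_sub]
  rw [← tendsto_add_atTop_iff_nat (f := fun k => ht l (X k)) n]
  simp only [add_comm n]
  refine ⟨fun h => ?_, fun h => tendsto_atTop_add_const_right _ (-ht l (X n)) h⟩
  simpa using tendsto_atTop_add_const_right _ (ht l (X n)) h

/-! ### The walk stays nonnegative with positive probability -/

lemma visits_congr {h h' : Path d} {n : ℕ} (H : ∀ i < n, h i = h' i) (z : Site d) :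
    visits h n z = visits h' n z := by
  unfold visits
  congr 1
  exact Finset.filter_congr fun i hi => by rw [H i (Finset.mem_range.1 hi)]

lemma quenched_cyl_ne_zero_iff {ω : Env d} {h : Path d} {n : ℕ} :
    quenched 0 ω (cyl h n) ≠ 0 ↔
      h 0 = 0 ∧ ∀ m < n, jump (ω (h m) (visits h m (h m))) (h m) {h (m + 1)} ≠ 0 := by
  rw [quenched_cyl]
  by_cases h0 : h 0 = 0
  · simp [h0, pathWeight, Finset.prod_eq_zero_iff]
  · simp [h0]

lemma quenched_cyl_update_ne_zero {ω : Env d} {h : Path d} {n : ℕ} {y : Site d}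
    (hh : quenched 0 ω (cyl h n) ≠ 0)
    (hy : jump (ω (h n) (visits h n (h n))) (h n) {y} ≠ 0) :
    quenched 0 ω (cyl (Function.update h (n + 1) y) (n + 1)) ≠ 0 := by
  rw [quenched_cyl_ne_zero_iff] at hh ⊢
  have hu : ∀ i ≤ n, Function.update h (n + 1) y i = h i := fun i hi =>
    Function.update_of_ne (by omega) _ _
  refine ⟨by rw [hu 0 (Nat.zero_le n), hh.1], fun m hm => ?_⟩
  rw [hu m (by omega), visits_congr fun i hi => hu i (by omega)]
  rcases Nat.lt_succ_iff_lt_or_eq.1 hm with hm' | rfl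
  · rw [hu (m + 1) (by omega)]
    exact hh.2 m hm'
  · rwa [Function.update_self]

/-- Exchange of the initial path: if the remaining environments agree on the part of the lattice
that the remaining walk visits, then the remaining walk has positive probability after either
path. -/
lemma quenched_ne_zero_of_exchange {ω ω' : Env d} {h h' : Path d} {n n' : ℕ} {S : Set (Site d)}
    {B A : Set (Path d)} (hB : MeasurableSet B) (hBS : ∀ X ∈ B, ∀ m, X m ∈ S)
    (hS : ∀ z ∈ S, after ω h n z = after ω' h' n' z) (hpos : quenched 0 (after ω h n) B ≠ 0)
    (hpath : quenched 0 ω' (cyl h' n') ≠ 0) (hsub : cyl h' n' ∩ post n' ⁻¹' B ⊆ A) :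
    quenched 0 ω' A ≠ 0 := by
  refine fun h0 => ?_
  have := measure_mono_null hsub h0
  rw [quenched_cyl_inter_post _ _ _ hB, ← quenched_congr hS hBS] at this
  exact (mul_ne_zero hpath hpos) this

lemma quenched_after_ne_zero {ω : Env d} {h : Path d} {n : ℕ} {B C : Set (Path d)}
    (hB : MeasurableSet B) (hC : quenched 0 ω (cyl h n ∩ C) ≠ 0)
    (hsub : cyl h n ∩ C ⊆ post n ⁻¹' B) : quenched 0 (after ω h n) B ≠ 0 := by
  intro h0
  refine hC (measure_mono_null (Set.subset_inter Set.inter_subset_left hsub) ?_)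
  rw [quenched_cyl_inter_post _ _ _ hB, h0, mul_zero]

lemma measurableSet_forall_mem (S : Set (Site d)) :
    MeasurableSet {X : Path d | ∀ m, X m ∈ S} := by
  have : {X : Path d | ∀ m, X m ∈ S} = ⋂ m, (fun X : Path d => X m) ⁻¹' S := by ext; simp
  rw [this]
  exact .iInter fun m => (measurable_pi_apply m) (.of_discrete)

lemma exists_post_mem_nonneg {l : EuclideanSpace ℝ (Fin d)} {X : Path d} (hX : X ∈ transient l) :
    ∃ n, post n X ∈ nonneg l := by
  have hX' : Tendsto (fun n => ht l (X n)) cofinite atTop := by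
    rw [Nat.cofinite_eq_atTop]; exact hX
  obtain ⟨n, hn⟩ := hX'.exists_forall_le
  refine ⟨n, fun k => ?_⟩
  simp only [post, ht_sub, sub_nonneg]
  exact hn _

/-- In an elliptic environment in which the walk may be transient, the walk started at a suitable
site may be transient without ever getting below its starting point. -/
lemma exists_quenched_shift_ne_zero {l : EuclideanSpace ℝ (Fin d)} {ω : Env d}
    (hell : ∀ z e i, 0 < (ω z i : Dir d → ℝ) e) (hω : quenched 0 ω (transient l) ≠ 0) :
    ∃ x, quenched 0 (shiftEnv x ω) (nonneg l ∩ transient l) ≠ 0 := by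
  have hG : MeasurableSet (nonneg l ∩ transient l) :=
    (measurableSet_nonneg l).inter (measurableSet_transient l)
  obtain ⟨n, h, -, hn⟩ := exists_cyl_pos hω (B := fun n => post n ⁻¹' (nonneg l ∩ transient l))
    fun X hX => by
      obtain ⟨n, hn⟩ := exists_post_mem_nonneg hX
      exact Set.mem_iUnion.2 ⟨n, hn, post_mem_transient.2 hX⟩
  replace hn := quenched_after_ne_zero hG hn Set.inter_subset_right
  refine ⟨h n, ?_⟩
  set F : Set (Site d) := {z | ∃ m < n, h m = z + h n} with hF
  have hFω : ∀ z ∉ F, after ω h n z = shiftEnv (h n) ω z := fun z hz =>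
    after_eq_shiftEnv fun m hm hmz => hz ⟨m, hm, by rw [← hmz, sub_add_cancel]⟩
  have hFfin : F.Finite := by
    refine ((Set.finite_Iio n).image fun m => h m - h n).subset ?_
    rintro z ⟨m, hm, hz⟩
    exact ⟨m, hm, by simp [hz]⟩
  obtain ⟨K, g, hg, hK⟩ := exists_cyl_pos hn
    (B := fun K => (nonneg l ∩ transient l) ∩ {Y | ∀ m, Y (K + m) ∉ F}) fun Y hY => by
      obtain ⟨b, hb⟩ := (hFfin.image (ht l)).bddAbove
      obtain ⟨K, hK⟩ := (hY.2.eventually_gt_atTop b).exists_forall_of_atTop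
      refine Set.mem_iUnion.2 ⟨K, hY, fun m hm => ?_⟩
      exact absurd (hb ⟨_, hm, rfl⟩) (not_le.2 (hK (K + m) (Nat.le_add_right K m)))
  set S : Set (Site d) := {z | z + g K ∉ F ∧ 0 ≤ ht l (z + g K)} with hSdef
  have hpath : quenched 0 (after ω h n) (cyl g K) ≠ 0 :=
    fun h0 => hK (measure_mono_null Set.inter_subset_left h0)
  have hB : MeasurableSet ({X : Path d | ∀ m, X m ∈ S} ∩ transient l) :=
    (measurableSet_forall_mem S).inter (measurableSet_transient l)
  refine quenched_ne_zero_of_exchange (ω := after ω h n) (h := g) (n := K) (h' := g) (n' := K)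
    (S := S) hB (fun X hX => hX.1) ?_ (quenched_after_ne_zero hB hK ?_) ?_ ?_
  · intro z hz
    funext i
    exact congrFun (hFω _ hz.1) _
  · rintro Y ⟨hYg, hYG, hYF⟩
    refine ⟨fun m => ?_, post_mem_transient.2 hYG.2⟩
    have : post K Y m + g K = Y (K + m) := by
      rw [post, hYg K le_rfl, sub_add_cancel]
    exact ⟨this ▸ hYF m, this ▸ hYG.1 _⟩
  · rw [quenched_cyl_ne_zero_iff] at hpath ⊢
    refine ⟨hpath.1, fun m hm => ?_⟩
    have hnn : ∃ e : Dir d, g (m + 1) = g m + e.vec := by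
      by_contra! hcon
      exact hpath.2 m hm (jump_singleton_eq_zero hcon)
    obtain ⟨e, he⟩ := hnn
    rw [he]
    exact jump_singleton_pos _ (hell _ _ _)
  · rintro Y ⟨hYg, hYS, hYt⟩
    refine ⟨fun m => ?_, post_mem_transient.1 hYt⟩
    rcases le_total m K with hm | hm
    · rw [hYg m hm]
      exact hg.1.1 m
    · obtain ⟨k, rfl⟩ := Nat.exists_eq_add_of_le hm
      have := (hYS k).2
      rwa [post, hYg K le_rfl, sub_add_cancel] at this

lemma annealed_nonneg_pos_of_EL {P : Measure (Env d)} [IsProbabilityMeasure P] (hP : IID P)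
    (hEL : EL P) {l : EuclideanSpace ℝ (Fin d)} (hl : annealed P (transient l) ≠ 0) :
    annealed P (nonneg l ∩ transient l) ≠ 0 := by
  have hG : MeasurableSet (nonneg l ∩ transient l) :=
    (measurableSet_nonneg l).inter (measurableSet_transient l)
  contrapose! hl
  rw [annealed_eq_zero_iff P hG] at hl
  rw [annealed_eq_zero_iff P (measurableSet_transient l)]
  have hell : ∀ᵐ ω ∂P, ∀ z e i, 0 < (ω z i : Dir d → ℝ) e := by
    simp_rw [ae_all_iff]
    exact hEL
  have hshift : ∀ᵐ ω ∂P, ∀ x, quenched 0 (shiftEnv x ω) (nonneg l ∩ transient l) = 0 := by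
    rw [ae_all_iff]
    intro x
    rw [← hP.map_shiftEnv x] at hl
    exact ae_of_ae_map (measurable_shiftEnv x).aemeasurable hl
  filter_upwards [hell, hshift] with ω h1 h2
  by_contra hcon
  obtain ⟨x, hx⟩ := exists_quenched_shift_ne_zero h1 hcon
  exact hx (h2 x)

/-! ### The one-dimensional case -/

/-- A direction which increases the height. -/
lemma exists_up {l : EuclideanSpace ℝ (Fin 1)} (hl : l ≠ 0) :
    ∃ (e : Dir 1) (c : ℝ), 0 < c ∧ ∀ z : Site 1, ht l z = c * ((e.2 : ℤ) * z 0 : ℤ) := by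
  have hht : ∀ z : Site 1, ht l z = l 0 * z 0 := by
    intro z
    simp [ht, toEuclid, PiLp.inner_apply]
  have hl0 : l 0 ≠ 0 := by
    intro h0
    apply hl
    ext j
    rw [Subsingleton.elim j 0, h0]; rfl
  rcases lt_or_gt_of_ne hl0 with h | h
  · exact ⟨(0, -1), -l 0, by linarith, fun z => by rw [hht]; push_cast; ring⟩
  · exact ⟨(0, 1), l 0, h, fun z => by rw [hht]; push_cast; ring⟩

/-- In dimension one, the excursions of a path into the negative half-line can be deleted. -/
lemma exists_nonneg_path {l : EuclideanSpace ℝ (Fin 1)} {e : Dir 1} {c : ℝ} (hc : 0 < c)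
    (he : ∀ z : Site 1, ht l z = c * ((e.2 : ℤ) * z 0 : ℤ)) {ω ω' : Env 1}
    (hω : ∀ z, 0 < ht l z → ω z = ω' z) (hup : ∀ i, 0 < (ω' 0 i : Dir 1 → ℝ) e)
    {h : Path 1} {n : ℕ} (hh : quenched 0 ω (cyl h n) ≠ 0) :
    ∃ (h' : Path 1) (n' : ℕ), (0 < ht l (h n) → h' n' = h n) ∧ (ht l (h n) ≤ 0 → h' n' = 0) ∧
      (∀ m ≤ n', 0 ≤ ht l (h' m)) ∧ quenched 0 ω' (cyl h' n') ≠ 0 ∧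
      ∀ z, 0 < ht l z → visits h' n' z = visits h n z := by
  have hpos : ∀ z, 0 < ht l z ↔ 0 < (e.2 : ℤ) * z 0 := by
    intro z
    rw [he, mul_pos_iff_of_pos_left hc]
    exact Int.cast_pos
  have hnonneg : ∀ z, 0 ≤ ht l z ↔ 0 ≤ (e.2 : ℤ) * z 0 := by
    intro z
    rw [he, mul_nonneg_iff_of_pos_left hc]
    exact Int.cast_nonneg_iff
  have hunit : ((e.2 : ℤ) = 1 ∨ (e.2 : ℤ) = -1) := Int.isUnit_iff.1 e.2.isUnit
  induction n with
  | zero =>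
    have h0 := (quenched_cyl_ne_zero_iff.1 hh).1
    refine ⟨fun _ => 0, 0, ?_, ?_, ?_, ?_, ?_⟩
    · intro _; exact h0.symm
    · intro _; rfl
    · intro m _; rw [ht_zero]
    · rw [quenched_cyl_ne_zero_iff]; simp
    · intro z _; simp [visits]
  | succ n ih =>
    have hh' := quenched_cyl_ne_zero_iff.1 hh
    have hprev : quenched 0 ω (cyl h n) ≠ 0 :=
      quenched_cyl_ne_zero_iff.2 ⟨hh'.1, fun m hm => hh'.2 m (by omega)⟩
    have hjump := hh'.2 n n.lt_succ_self
    obtain ⟨h', n', h1, h2, h3, h4, h5⟩ := ih hprev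
    have hnn : ∃ e' : Dir 1, h (n + 1) = h n + e'.vec := by
      by_contra! hcon
      exact hjump (jump_singleton_eq_zero hcon)
    obtain ⟨e', he'⟩ := hnn
    have hstep : h (n + 1) 0 = h n 0 + (e'.2 : ℤ) := by
      rw [he', Pi.add_apply, Dir.vec, Subsingleton.elim e'.1 0, Pi.single_eq_same]
    have hunit' : ((e'.2 : ℤ) = 1 ∨ (e'.2 : ℤ) = -1) := Int.isUnit_iff.1 e'.2.isUnit
    have hv : ∀ z, visits h (n + 1) z = visits h n z + if h n = z then 1 else 0 := visits_succ h n
    have hext : ∀ y : Site 1, jump (ω' (h' n') (visits h' n' (h' n'))) (h' n') {y} ≠ 0 →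
        0 ≤ ht l y → (∀ m ≤ n' + 1, 0 ≤ ht l (Function.update h' (n' + 1) y m)) ∧
        quenched 0 ω' (cyl (Function.update h' (n' + 1) y) (n' + 1)) ≠ 0 ∧
        ∀ z, visits (Function.update h' (n' + 1) y) (n' + 1) z =
          visits h' n' z + if h' n' = z then 1 else 0 := by
      intro y hy hy0
      refine ⟨fun m hm => ?_, quenched_cyl_update_ne_zero h4 hy, fun z => ?_⟩
      · rcases Nat.lt_succ_iff_lt_or_eq.1 (Nat.lt_succ_of_le hm) with hm' | rfl
        · rw [Function.update_of_ne (by omega)]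
          exact h3 m (by omega)
        · rwa [Function.update_self]
      · rw [visits_congr (h' := h') fun i hi => Function.update_of_ne (by omega) _ _, visits_succ]
    rcases lt_or_ge 0 (ht l (h n)) with hn | hn
    · have hn' := h1 hn
      have hy : jump (ω' (h' n') (visits h' n' (h' n'))) (h' n') {h (n + 1)} ≠ 0 := by
        rw [hn', h5 _ hn, ← hω _ hn]
        exact hjump
      have hy0 : 0 ≤ ht l (h (n + 1)) := by
        rw [hpos] at hn
        rw [hnonneg, hstep]
        rcases hunit with hu | hu <;> rcases hunit' with hu' | hu' <;> rw [hu] at hn ⊢ <;>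
          rw [hu'] <;> omega
      obtain ⟨g1, g2, g3⟩ := hext _ hy hy0
      refine ⟨Function.update h' (n' + 1) (h (n + 1)), n' + 1, ?_, ?_, g1, g2, ?_⟩
      · intro _; exact Function.update_self ..
      · intro hle
        rw [Function.update_self]
        have h00 : ht l (h (n + 1)) = 0 := le_antisymm hle hy0
        ext j
        rw [Subsingleton.elim j 0]
        rw [he, mul_eq_zero, Int.cast_eq_zero] at h00
        rcases h00 with h00 | h00
        · exact absurd h00 hc.ne'
        · rcases hunit with hu | hu <;> rw [hu] at h00 <;> simpa using h00
      · intro z hz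
        rw [g3, hv, h5 z hz, hn']
    · have hn' := h2 hn
      have hvz : ∀ z, 0 < ht l z → visits h (n + 1) z = visits h n z := by
        intro z hz
        rw [hv, if_neg, add_zero]
        rintro rfl
        exact absurd hz (not_lt.2 hn)
      rcases lt_or_ge 0 (ht l (h (n + 1))) with hn1 | hn1
      · have hhe : h (n + 1) = 0 + e.vec := by
          ext j
          rw [Subsingleton.elim j 0, zero_add, Dir.vec, Subsingleton.elim e.1 0, Pi.single_eq_same]
          rw [hpos] at hn1
          rw [← not_lt, hpos, not_lt] at hn
          rw [hstep] at hn1 ⊢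
          rcases hunit with hu | hu <;> rcases hunit' with hu' | hu' <;> rw [hu] at hn hn1 ⊢ <;>
            rw [hu'] at hn1 ⊢ <;> omega
        have hy : jump (ω' (h' n') (visits h' n' (h' n'))) (h' n') {h (n + 1)} ≠ 0 := by
          rw [hn', hhe]
          exact jump_singleton_pos _ (hup _)
        obtain ⟨g1, g2, g3⟩ := hext _ hy hn1.le
        refine ⟨Function.update h' (n' + 1) (h (n + 1)), n' + 1, ?_, ?_, g1, g2, ?_⟩
        · intro _; exact Function.update_self ..
        · intro hle; exact absurd hle (not_le.2 hn1)
        · intro z hz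
          rw [g3, hvz z hz, h5 z hz, if_neg, add_zero]
          rintro rfl
          rw [hn', ht_zero] at hz
          exact lt_irrefl _ hz
      · exact ⟨h', n', fun h => absurd h (not_lt.2 hn1), fun _ => hn', h3, h4,
          fun z hz => (h5 z hz).trans (hvz z hz).symm⟩

/-- In dimension one, transience only depends on the positive half-line. -/
lemma quenched_nonneg_ne_zero_of_transient {l : EuclideanSpace ℝ (Fin 1)} {e : Dir 1} {c : ℝ}
    (hc : 0 < c) (he : ∀ z : Site 1, ht l z = c * ((e.2 : ℤ) * z 0 : ℤ)) {ω ω' : Env 1}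
    (hω : ∀ z, 0 < ht l z → ω z = ω' z) (hup : ∀ i, 0 < (ω' 0 i : Dir 1 → ℝ) e)
    (htr : quenched 0 ω (transient l) ≠ 0) : quenched 0 ω' (nonneg l ∩ transient l) ≠ 0 := by
  obtain ⟨n, h, hh, hn⟩ := exists_cyl_pos htr
    (B := fun n => {X | ∀ m, 0 < ht l (X (n + m))} ∩ transient l) fun X hX => by
      obtain ⟨n, hn⟩ := (hX.eventually_gt_atTop 0).exists_forall_of_atTop
      exact Set.mem_iUnion.2 ⟨n, fun m => hn _ (Nat.le_add_right n m), hX⟩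
  obtain ⟨h', n', h1, -, h3, h4, h5⟩ := exists_nonneg_path hc he hω hup
    fun h0 => hn (measure_mono_null Set.inter_subset_left h0)
  replace h1 := h1 (hh.1 0)
  set S : Set (Site 1) := {z | 0 < ht l (z + h n)} with hS
  have hB : MeasurableSet ({X : Path 1 | ∀ m, X m ∈ S} ∩ transient l) :=
    (measurableSet_forall_mem S).inter (measurableSet_transient l)
  refine quenched_ne_zero_of_exchange (ω := ω) (h := h) (n := n) (h' := h') (n' := n')
    (S := S) hB (fun X hX => hX.1) ?_ (quenched_after_ne_zero hB hn ?_) h4 ?_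
  · intro z hz
    funext i
    simp only [after, h1, h5 _ hz, hω _ hz]
  · rintro Y ⟨hYh, hY, hYt⟩
    refine ⟨fun m => ?_, post_mem_transient.2 hYt⟩
    have := hY m
    rwa [hS, Set.mem_ofPred_eq, post, hYh n le_rfl, sub_add_cancel]
  · rintro Y ⟨hYh, hYS, hYt⟩
    refine ⟨fun m => ?_, post_mem_transient.1 hYt⟩
    rcases le_total m n' with hm | hm
    · rw [hYh m hm]
      exact h3 m hm
    · obtain ⟨k, rfl⟩ := Nat.exists_eq_add_of_le hm
      have := hYS k
      rw [hS, Set.mem_ofPred_eq, post, hYh n' le_rfl, h1, sub_add_cancel] at this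
      exact this.le

lemma annealed_nonneg_pos_of_WEL {P : Measure (Env 1)} [IsProbabilityMeasure P] (hP : IID P)
    (hWEL : WEL P) {l : EuclideanSpace ℝ (Fin 1)} (hl : annealed P (transient l) ≠ 0) :
    annealed P (nonneg l ∩ transient l) ≠ 0 := by
  classical
  have hG : MeasurableSet (nonneg l ∩ transient l) :=
    (measurableSet_nonneg l).inter (measurableSet_transient l)
  have hl0 : l ≠ 0 := by
    rintro rfl
    apply hl
    have : transient (0 : EuclideanSpace ℝ (Fin 1)) = ∅ := by
      rw [Set.eq_empty_iff_forall_notMem]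
      intro X hX
      have hX' : Tendsto (fun _ : ℕ => (0 : ℝ)) atTop atTop := by
        simpa [transient, ht] using hX
      exact not_tendsto_const_atTop _ _ hX'
    rw [this, measure_empty]
  obtain ⟨e, c, hc, he⟩ := exists_up hl0
  have hht0 : ∀ z : Site 1, 0 < ht l z → z ≠ 0 := by
    rintro z hz rfl
    rw [ht_zero] at hz
    exact lt_irrefl _ hz
  let up : Cookie 1 := ⟨Pi.single e 1, single_mem_stdSimplex ℝ e⟩
  let star : Env 1 → Env 1 := fun ω => Function.update ω 0 fun _ => up
  have hstar : ∀ ω z, z ≠ 0 → star ω z = ω z := fun ω z hz => Function.update_of_ne hz _ _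
  have hstar0 : ∀ ω i, 0 < (star ω 0 i : Dir 1 → ℝ) e := by
    intro ω i
    simp [star, up]
  have hstarm : Measurable star := by
    refine measurable_pi_lambda _ fun z => ?_
    by_cases hz : z = 0
    · subst hz
      simp [star]
    · simp only [hstar _ z hz]
      exact measurable_pi_apply z
  set ell : Set (ℕ → Cookie 1) := {s | ∀ i, 0 < (s i : Dir 1 → ℝ) e} with hell
  have hellm : MeasurableSet ell := by
    have : ell = ⋂ i, {s | 0 < (s i : Dir 1 → ℝ) e} := by ext; simp [hell]
    rw [this]
    refine .iInter fun i => measurableSet_lt measurable_const ?_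
    exact (measurable_pi_apply e).comp (measurable_subtype_coe.comp (measurable_pi_apply i))
  have hind : IndepFun (fun ω : Env 1 => quenched 0 (star ω) (nonneg l ∩ transient l))
      (fun ω : Env 1 => ell.indicator (fun _ => (1 : ℝ≥0∞)) (ω 0)) P := by
    refine hP.indepFun {0}ᶜ ((measurable_quenched_apply 0 hG).comp hstarm)
      ((measurable_const.indicator hellm).comp (measurable_pi_apply 0)) ?_ ?_
    · intro ω ω' H
      have : star ω = star ω' := by
        funext z
        by_cases hz : z = 0
        · subst hz; simp [star]
        · rw [hstar _ _ hz, hstar _ _ hz, H z hz]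
      rw [this]
    · intro ω ω' H
      rw [H 0 (by simp)]
  have hmul := hind.measure_inter_preimage_eq_mul {0}ᶜ {0}ᶜ (measurableSet_singleton _).compl
    (measurableSet_singleton _).compl
  contrapose! hl
  rw [annealed_eq_zero_iff P hG] at hl
  rw [annealed_eq_zero_iff P (measurableSet_transient l)]
  have hz : P ((fun ω : Env 1 => quenched 0 (star ω) (nonneg l ∩ transient l)) ⁻¹' {0}ᶜ ∩
      (fun ω : Env 1 => ell.indicator (fun _ => (1 : ℝ≥0∞)) (ω 0)) ⁻¹' {0}ᶜ) = 0 := by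
    refine measure_mono_null ?_ hl
    rintro ω ⟨h1, h2⟩
    have h2' : ω 0 ∈ ell := by
      by_contra hcon
      exact h2 (Set.indicator_of_notMem hcon _)
    refine quenched_nonneg_ne_zero_of_transient (ω := star ω) hc he
      (fun z hz => hstar _ _ (hht0 z hz)) h2' fun h0 => h1 ?_
    exact measure_mono_null Set.inter_subset_right h0
  rw [hmul, mul_eq_zero] at hz
  have hWEL' := (hWEL 0 e).ne'
  rcases hz with hz | hz
  · refine measure_mono_null ?_ hz
    intro ω hω
    exact quenched_nonneg_ne_zero_of_transient hc he
      (fun z hz => (hstar _ _ (hht0 z hz)).symm) (hstar0 ω) hω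
  · refine absurd (measure_mono_null ?_ hz) hWEL'
    intro ω hω
    have : ω 0 ∈ ell := hω
    simp [this]

/-! ### Regeneration times -/

/-- Trajectories which at time `n` are strictly higher than ever before. -/
def strictMax (l : EuclideanSpace ℝ (Fin d)) (n : ℕ) : Set (Path d) :=
  {X | ∀ m < n, ht l (X m) < ht l (X n)}

/-- Trajectories for which `n` is a regeneration time: the height stays below its value at time `n`
before `n`, and never gets below this value afterwards. -/
def regAt (l : EuclideanSpace ℝ (Fin d)) (n : ℕ) : Set (Path d) :=
  strictMax l n ∩ post n ⁻¹' nonneg l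

lemma determinedBy_strictMax (l : EuclideanSpace ℝ (Fin d)) (n : ℕ) :
    DeterminedBy n (strictMax l n) := by
  intro X Y h hX m hm
  rw [← h m hm.le, ← h n le_rfl]
  exact hX m hm

lemma measurableSet_regAt (l : EuclideanSpace ℝ (Fin d)) (n : ℕ) : MeasurableSet (regAt l n) :=
  (determinedBy_strictMax l n).measurableSet.inter (measurable_post n (measurableSet_nonneg l))

lemma mem_post_nonneg {l : EuclideanSpace ℝ (Fin d)} {n : ℕ} {X : Path d} :
    post n X ∈ nonneg l ↔ ∀ k, n ≤ k → ht l (X n) ≤ ht l (X k) := by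
  simp only [nonneg, post, Set.mem_ofPred_eq, ht_sub, sub_nonneg]
  constructor
  · intro h k hk
    obtain ⟨m, rfl⟩ := Nat.exists_eq_add_of_le hk
    exact h m
  · exact fun h m => h _ (Nat.le_add_right n m)

/-- Independence of the past and the future at a strict maximum. -/
lemma annealed_strictMax_inter_post {P : Measure (Env d)} [IsProbabilityMeasure P] (hP : IID P)
    {l : EuclideanSpace ℝ (Fin d)} {n : ℕ} {E : Set (Path d)} (hE : DeterminedBy n E)
    (hEmax : E ⊆ strictMax l n) {A : Set (Path d)} (hA : MeasurableSet A) (hAl : A ⊆ nonneg l) :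
    annealed P (E ∩ post n ⁻¹' A) = annealed P E * annealed P A := by
  refine annealed_inter_post hP hE (S := {z | 0 ≤ ht l z}) ?_ hA fun X hX m => hAl hX m
  intro h hh m hm hmem
  have := hEmax hh m hm
  rw [Set.mem_ofPred_eq, ht_sub] at hmem
  linarith

lemma exists_strictMax {l : EuclideanSpace ℝ (Fin d)} {X : Path d} (hX : X ∈ transient l) (N : ℕ) :
    ∃ n, N < n ∧ X ∈ strictMax l n := by
  classical
  have hex : ∃ n, N < n ∧ ∀ m ≤ N, ht l (X m) < ht l (X n) := by
    obtain ⟨b, hb⟩ := ((Set.finite_Iic N).image fun m => ht l (X m)).bddAbove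
    obtain ⟨n, hn, hn'⟩ := ((hX.eventually_gt_atTop b).and (eventually_gt_atTop N)).exists
    exact ⟨n, hn', fun m hm => (hb ⟨m, hm, rfl⟩).trans_lt hn⟩
  refine ⟨Nat.find hex, (Nat.find_spec hex).1, fun m hm => ?_⟩
  rcases le_or_gt m N with hmN | hmN
  · exact (Nat.find_spec hex).2 m hmN
  · have := Nat.find_min hex hm
    push Not at this
    obtain ⟨k, hk, hk'⟩ := this hmN
    exact hk'.trans_lt ((Nat.find_spec hex).2 k hk)

lemma isSetRing_determinedBy : IsSetRing {E : Set (Path d) | ∃ n, DeterminedBy n E} where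
  empty_mem := ⟨0, fun _ _ _ h => h⟩
  union_mem := by
    rintro E F ⟨n, hn⟩ ⟨m, hm⟩
    refine ⟨max n m, fun X Y h hX => ?_⟩
    rcases hX with hX | hX
    · exact Or.inl (hn.mono (le_max_left n m) X Y h hX)
    · exact Or.inr (hm.mono (le_max_right n m) X Y h hX)
  sdiff_mem := by
    rintro E F ⟨n, hn⟩ ⟨m, hm⟩
    refine ⟨max n m, fun X Y h hX => ⟨hn.mono (le_max_left n m) X Y h hX.1, fun hY => hX.2 ?_⟩⟩
    exact hm.mono (le_max_right n m) Y X (fun i hi => (h i hi).symm) hY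

lemma generateFrom_determinedBy :
    (inferInstance : MeasurableSpace (Path d)) =
      MeasurableSpace.generateFrom {E : Set (Path d) | ∃ n, DeterminedBy n E} := by
  refine le_antisymm ?_ (MeasurableSpace.generateFrom_le fun E ⟨n, hn⟩ => hn.measurableSet)
  refine (generateFrom_measurableCylinders (α := fun _ : ℕ => Site d)).symm.le.trans
    (MeasurableSpace.generateFrom_mono ?_)
  intro s hs
  obtain ⟨I, S, hS, rfl⟩ := (mem_measurableCylinders _).1 hs
  refine ⟨I.sup id, fun X Y hXY hX => ?_⟩
  have : I.restrict (π := fun _ : ℕ => Site d) X = I.restrict (π := fun _ : ℕ => Site d) Y := by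
    ext1 i
    exact hXY i (Finset.le_sup (f := id) i.2)
  simpa only [mem_cylinder, this] using hX

/-- An event that never has conditional probability close to `1` given finite parts of the
trajectory is a null set. -/
lemma measure_eq_zero_of_forall_determinedBy {μ : Measure (Path d)} [IsProbabilityMeasure μ]
    {B : Set (Path d)} (hB : MeasurableSet B) {q : ℝ≥0∞} (hq : q < 1)
    (h : ∀ n E, DeterminedBy n E → μ (B ∩ E) ≤ q * μ E) : μ B = 0 := by
  have key : ∀ ε : ℝ≥0∞, 0 < ε → μ B ≤ q * μ B + (ε + ε) := by
    intro ε hε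
    obtain ⟨t, ⟨n, ht⟩, hlt⟩ := exists_measure_symmDiff_lt_of_generateFrom_isSetRing (μ := μ)
      isSetRing_determinedBy ⟨{Set.univ}, Set.countable_singleton _, by
        rintro _ rfl; exact ⟨0, fun _ _ _ _ => trivial⟩, by simp⟩ generateFrom_determinedBy hB hε
    have h1 : μ B ≤ μ (B ∩ t) + ε := by
      refine (measure_le_inter_add_sdiff μ B t).trans ?_
      gcongr
      exact (measure_mono Set.subset_union_right).trans hlt.le
    have h2 : μ t ≤ μ B + ε := by
      refine (measure_le_inter_add_sdiff μ t B).trans ?_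
      gcongr
      · exact Set.inter_subset_right
      · exact (measure_mono Set.subset_union_left).trans hlt.le
    calc μ B ≤ μ (B ∩ t) + ε := h1
      _ ≤ q * (μ B + ε) + ε := by gcongr; exact (h n t ht).trans (by gcongr)
      _ ≤ q * μ B + (ε + ε) := by
        rw [mul_add, add_assoc]
        gcongr
        exact mul_le_of_le_one_left' hq.le
  have hle : μ B ≤ q * μ B := by
    refine ENNReal.le_of_forall_pos_le_add fun ε hε _ => ?_
    refine (key (ε / 2) ?_).trans_eq ?_
    · simpa using hε.ne'
    · rw [ENNReal.add_halves]
  by_contra hne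
  have : q * μ B < 1 * μ B := (ENNReal.mul_lt_mul_iff_left hne (measure_ne_top _ _)).2 hq
  rw [one_mul] at this
  exact absurd hle (not_le.2 this)

/-- If the walk stays nonnegative with positive probability, then there is almost surely a
regeneration time on the event that the walk is transient. -/
lemma annealed_exists_regAt {P : Measure (Env d)} [IsProbabilityMeasure P] (hP : IID P)
    {l : EuclideanSpace ℝ (Fin d)} (hpos : annealed P (nonneg l) ≠ 0) :
    ∀ᵐ X ∂(annealed P), X ∈ transient l → ∃ n, 1 ≤ n ∧ X ∈ regAt l n := by
  set B : Set (Path d) := transient l ∩ ⋂ n, {X | 1 ≤ n → X ∉ regAt l n} with hBdef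
  have hB : MeasurableSet B := by
    refine (measurableSet_transient l).inter (.iInter fun n => ?_)
    exact .imp (.const _) (measurableSet_regAt l n).compl
  suffices hB0 : annealed P B = 0 by
    refine measure_mono_null ?_ hB0
    intro X hX
    simp only [Set.mem_compl_iff, Set.mem_ofPred_eq, Classical.not_imp, not_exists, not_and] at hX
    exact ⟨hX.1, Set.mem_iInter.2 hX.2⟩
  have hq : 1 - annealed P (nonneg l) < 1 :=
    ENNReal.sub_lt_self ENNReal.one_ne_top one_ne_zero hpos
  refine measure_eq_zero_of_forall_determinedBy hB hq fun N C hC => ?_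
  set E : ℕ → Set (Path d) := fun n =>
    {X | N < n ∧ X ∈ strictMax l n ∧ ∀ m, N < m → m < n → X ∉ strictMax l m} with hE
  have hEdet : ∀ n, DeterminedBy n (E n) := by
    rintro n X Y h ⟨h1, h2, h3⟩
    refine ⟨h1, determinedBy_strictMax l n X Y h h2, fun m hm hmn hY => h3 m hm hmn ?_⟩
    exact (determinedBy_strictMax l m).mono hmn.le Y X (fun i hi => (h i hi).symm) hY
  have hECdet : ∀ n, DeterminedBy n (E n ∩ C) := by
    intro n X Y h hX
    exact ⟨hEdet n X Y h hX.1, hC.mono hX.1.1.le X Y h hX.2⟩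
  have hdisj : Pairwise (Function.onFun Disjoint fun n => E n ∩ C) := by
    have : ∀ n m, n < m → Disjoint (E n ∩ C) (E m ∩ C) := by
      intro n m hnm
      rw [Set.disjoint_left]
      rintro X ⟨⟨h1, h2, -⟩, -⟩ ⟨⟨-, -, h3⟩, -⟩
      exact h3 n h1 hnm h2
    intro n m hnm
    rcases lt_or_gt_of_ne hnm with h | h
    · exact this n m h
    · exact (this m n h).symm
  have hcov : B ∩ C ⊆ ⋃ n, (E n ∩ C) ∩ post n ⁻¹' (nonneg l)ᶜ := by
    classical
    rintro X ⟨⟨hXt, hXr⟩, hXC⟩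
    have hex := exists_strictMax hXt N
    refine Set.mem_iUnion.2 ⟨Nat.find hex, ⟨⟨(Nat.find_spec hex).1, (Nat.find_spec hex).2, ?_⟩,
      hXC⟩, ?_⟩
    · intro m hm hmn hX
      exact Nat.find_min hex hmn ⟨hm, hX⟩
    · intro hmem
      have h1 : 1 ≤ Nat.find hex := (Nat.zero_le N).trans_lt (Nat.find_spec hex).1
      exact Set.mem_iInter.1 hXr _ h1 ⟨(Nat.find_spec hex).2, hmem⟩
  have hbound : ∀ n, annealed P ((E n ∩ C) ∩ post n ⁻¹' (nonneg l)ᶜ) =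
      annealed P (E n ∩ C) * (1 - annealed P (nonneg l)) := by
    intro n
    have h1 := measure_inter_add_sdiff (μ := annealed P) (E n ∩ C)
      (measurable_post n (measurableSet_nonneg l))
    rw [annealed_strictMax_inter_post hP (hECdet n) (fun X hX => hX.1.2.1)
      (measurableSet_nonneg l) le_rfl] at h1
    rw [ENNReal.mul_sub fun _ _ => measure_ne_top _ _, mul_one]
    refine ENNReal.eq_sub_of_add_eq (ENNReal.mul_ne_top (measure_ne_top _ _) (measure_ne_top _ _)) ?_
    rw [add_comm]
    exact h1
  calc annealed P (B ∩ C) ≤ ∑' n, annealed P ((E n ∩ C) ∩ post n ⁻¹' (nonneg l)ᶜ) :=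
        (measure_mono hcov).trans (measure_iUnion_le _)
    _ = (∑' n, annealed P (E n ∩ C)) * (1 - annealed P (nonneg l)) := by
        simp_rw [hbound, ENNReal.tsum_mul_right]
    _ ≤ annealed P C * (1 - annealed P (nonneg l)) := by
        gcongr
        rw [← measure_iUnion hdisj fun n => (hECdet n).measurableSet]
        exact measure_mono (Set.iUnion_subset fun n => Set.inter_subset_right)
    _ = _ := mul_comm _ _

/-! ### Independence of the regeneration blocks -/

/-- Transient trajectories that start at a regeneration time. -/
def good (l : EuclideanSpace ℝ (Fin d)) : Set (Path d) := nonneg l ∩ transient l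

/-- The first regeneration time after time `0`. -/
noncomputable def regTime (l : EuclideanSpace ℝ (Fin d)) (X : Path d) : ℕ :=
  sInf {n | 1 ≤ n ∧ X ∈ regAt l n}

/-- The trajectory after its first regeneration time. -/
noncomputable def regShift (l : EuclideanSpace ℝ (Fin d)) (X : Path d) : Path d :=
  post (regTime l X) X

/-- Duration and displacement of the first regeneration block. -/
noncomputable def block (l : EuclideanSpace ℝ (Fin d)) (X : Path d) : ℕ × Site d :=
  (regTime l X, X (regTime l X))

lemma measurableSet_good (l : EuclideanSpace ℝ (Fin d)) : MeasurableSet (good l) :=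
  (measurableSet_nonneg l).inter (measurableSet_transient l)

lemma regTime_eq_iff {l : EuclideanSpace ℝ (Fin d)} {X : Path d} {n : ℕ} (hn : 1 ≤ n) :
    regTime l X = n ↔ X ∈ regAt l n ∧ ∀ m, 1 ≤ m → m < n → X ∉ regAt l m := by
  constructor
  · rintro rfl
    have hne : {n | 1 ≤ n ∧ X ∈ regAt l n}.Nonempty := Nat.nonempty_of_pos_sInf hn
    refine ⟨(Nat.sInf_mem hne).2, fun m hm hlt hX => ?_⟩
    exact Nat.notMem_of_lt_sInf hlt ⟨hm, hX⟩
  · rintro ⟨h1, h2⟩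
    refine le_antisymm (Nat.sInf_le ⟨hn, h1⟩) (le_csInf ⟨n, hn, h1⟩ ?_)
    rintro m ⟨hm, hX⟩
    by_contra hlt
    exact h2 m hm (not_le.1 hlt) hX

lemma regTime_spec {l : EuclideanSpace ℝ (Fin d)} {X : Path d}
    (h : ∃ n, 1 ≤ n ∧ X ∈ regAt l n) : 1 ≤ regTime l X ∧ X ∈ regAt l (regTime l X) :=
  Nat.sInf_mem (s := {n | 1 ≤ n ∧ X ∈ regAt l n}) h

lemma measurable_regTime (l : EuclideanSpace ℝ (Fin d)) : Measurable (regTime (d := d) l) := by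
  have h1 : ∀ n, 1 ≤ n → MeasurableSet (regTime l ⁻¹' {n}) := by
    intro n hn
    have : regTime l ⁻¹' {n} = regAt l n ∩ ⋂ m, {X | 1 ≤ m → m < n → X ∉ regAt l m} := by
      ext X
      simp [regTime_eq_iff hn]
    rw [this]
    refine (measurableSet_regAt l n).inter (.iInter fun m => ?_)
    exact .imp (.const _) (.imp (.const _) (measurableSet_regAt l m).compl)
  refine measurable_to_countable' fun n => ?_
  rcases Nat.eq_zero_or_pos n with rfl | hn
  · have : regTime l ⁻¹' {0} = (⋃ n, regTime l ⁻¹' {n + 1})ᶜ := by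
      ext X
      simp only [Set.mem_preimage, Set.mem_singleton_iff, Set.mem_compl_iff, Set.mem_iUnion]
      constructor
      · rintro h ⟨n, hn⟩; omega
      · intro h
        by_contra h0
        exact h ⟨regTime l X - 1, by omega⟩
    rw [this]
    exact (MeasurableSet.iUnion fun n => h1 _ (by omega)).compl
  · exact h1 n hn

lemma measurable_regShift (l : EuclideanSpace ℝ (Fin d)) : Measurable (regShift (d := d) l) := by
  have : Measurable fun p : ℕ × Path d => post p.1 p.2 :=
    measurable_from_prod_countable_right fun n => measurable_post n
  exact this.comp ((measurable_regTime l).prodMk measurable_id)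

lemma measurable_block (l : EuclideanSpace ℝ (Fin d)) : Measurable (block (d := d) l) := by
  have : Measurable fun p : ℕ × Path d => p.2 p.1 :=
    measurable_from_prod_countable_right fun n => measurable_pi_apply n
  exact (measurable_regTime l).prodMk (this.comp ((measurable_regTime l).prodMk measurable_id))

/-- The finite paths that may be a first regeneration block. -/
def firstBlock (l : EuclideanSpace ℝ (Fin d)) (n : ℕ) : Set (Path d) :=
  {X | (∀ m ≤ n, 0 ≤ ht l (X m)) ∧ X ∈ strictMax l n ∧ ∀ m, 1 ≤ m → m < n → X ∈ strictMax l m →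
    ∃ k, m ≤ k ∧ k ≤ n ∧ ht l (X k) < ht l (X m)}

lemma determinedBy_firstBlock (l : EuclideanSpace ℝ (Fin d)) (n : ℕ) :
    DeterminedBy n (firstBlock l n) := by
  rintro X Y h ⟨h1, h2, h3⟩
  refine ⟨fun m hm => h m hm ▸ h1 m hm, determinedBy_strictMax l n X Y h h2, ?_⟩
  intro m hm hmn hY
  obtain ⟨k, hk, hkn, hlt⟩ := h3 m hm hmn ((determinedBy_strictMax l m).mono hmn.le Y X
    (fun i hi => (h i hi).symm) hY)
  exact ⟨k, hk, hkn, by rwa [← h k hkn, ← h m hmn.le]⟩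

lemma good_inter_regTime {l : EuclideanSpace ℝ (Fin d)} {X : Path d} {n : ℕ} (hn : 1 ≤ n) :
    (X ∈ good l ∧ regTime l X = n) ↔ X ∈ firstBlock l n ∧ post n X ∈ good l := by
  rw [regTime_eq_iff hn]
  constructor
  · rintro ⟨⟨hX0, hXt⟩, ⟨hmax, hpost⟩, hfirst⟩
    refine ⟨⟨fun m _ => hX0 m, hmax, fun m hm hmn hXm => ?_⟩, hpost, post_mem_transient.2 hXt⟩
    have : post m X ∉ nonneg l := fun h => hfirst m hm hmn ⟨hXm, h⟩
    rw [mem_post_nonneg] at this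
    push Not at this
    obtain ⟨k, hk, hlt⟩ := this
    refine ⟨k, hk, ?_, hlt⟩
    by_contra hkn
    have := mem_post_nonneg.1 hpost k (not_le.1 hkn).le
    exact absurd (hmax m hmn) (not_lt.2 (this.trans hlt.le))
  · rintro ⟨⟨h1, h2, h3⟩, hpost, hpt⟩
    have h4 := mem_post_nonneg.1 hpost
    refine ⟨⟨fun k => ?_, post_mem_transient.1 hpt⟩, ⟨h2, hpost⟩, ?_⟩
    · rcases le_total k n with hk | hk
      · exact h1 k hk
      · exact (h1 n le_rfl).trans (h4 k hk)
    · rintro m hm hmn ⟨hXm, hXp⟩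
      obtain ⟨k, hk, -, hlt⟩ := h3 m hm hmn hXm
      exact absurd (mem_post_nonneg.1 hXp k hk) (not_le.2 hlt)

/-- Law of the walk conditioned to be transient and to start at a regeneration time. -/
noncomputable def regLaw (P : Measure (Env d)) (l : EuclideanSpace ℝ (Fin d)) :
    Measure (Path d) := ProbabilityTheory.cond (annealed P) (good l)

lemma ae_regLaw_of_ae {P : Measure (Env d)} {l : EuclideanSpace ℝ (Fin d)} {p : Path d → Prop}
    (h : ∀ᵐ X ∂(annealed P), p X) :
    ∀ᵐ X ∂(regLaw P l), p X := (cond_absolutelyContinuous (μ := annealed P)).ae_le h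

lemma ae_regLaw_good {P : Measure (Env d)} {l : EuclideanSpace ℝ (Fin d)} :
    ∀ᵐ X ∂(regLaw P l), X ∈ good l := by
  unfold regLaw
  exact ae_cond_mem (measurableSet_good l)

section Regeneration

variable {P : Measure (Env d)} [IsProbabilityMeasure P] {l : EuclideanSpace ℝ (Fin d)}

lemma annealed_block_inter (hP : IID P) (hpos : annealed P (good l) ≠ 0) :
    ∃ c : Set (ℕ × Site d) → ℝ≥0∞, ∀ U (B : Set (Path d)), MeasurableSet B →
      annealed P (good l ∩ (block l ⁻¹' U ∩ regShift l ⁻¹' B)) =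
        c U * annealed P (good l ∩ B) := by
  have hnn : annealed P (nonneg l) ≠ 0 := fun h0 =>
    hpos (measure_mono_null Set.inter_subset_left h0)
  refine ⟨fun U => ∑' n, annealed P (firstBlock l (n + 1) ∩ {X | (n + 1, X (n + 1)) ∈ U}),
    fun U B hB => ?_⟩
  have hdet : ∀ n, DeterminedBy (n + 1) (firstBlock l (n + 1) ∩ {X | (n + 1, X (n + 1)) ∈ U}) := by
    intro n
    refine (determinedBy_firstBlock l _).inter fun X Y h hX => ?_
    rw [Set.mem_ofPred_eq, ← h (n + 1) le_rfl]
    exact hX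
  have hpiece : ∀ n, annealed P (good l ∩ (block l ⁻¹' U ∩ regShift l ⁻¹' B) ∩
      regTime l ⁻¹' {n + 1}) = annealed P (firstBlock l (n + 1) ∩ {X | (n + 1, X (n + 1)) ∈ U}) *
        annealed P (good l ∩ B) := by
    intro n
    rw [← annealed_strictMax_inter_post hP (hdet n) (fun X hX => hX.1.2.1)
      ((measurableSet_good l).inter hB) fun X hX => hX.1.1]
    congr 1
    ext X
    constructor
    · rintro ⟨⟨h1, h2, h3⟩, h4⟩
      have h4 : regTime l X = n + 1 := h4
      have h5 := (good_inter_regTime (by omega)).1 ⟨h1, h4⟩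
      simp only [block, regShift, Set.mem_preimage, h4] at h2 h3
      exact ⟨⟨h5.1, h2⟩, h5.2, h3⟩
    · rintro ⟨⟨h1, h2⟩, h3, h4⟩
      obtain ⟨h5, h6⟩ := (good_inter_regTime (by omega)).2 ⟨h1, h3⟩
      refine ⟨⟨h5, ?_⟩, h6⟩
      simp only [block, regShift, Set.mem_preimage, h6, Set.mem_inter_iff]
      exact ⟨h2, h4⟩
  rw [← ENNReal.tsum_mul_right]
  simp_rw [← hpiece]
  have hmeas : MeasurableSet (good l ∩ (block l ⁻¹' U ∩ regShift l ⁻¹' B)) :=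
    (measurableSet_good l).inter ((measurable_block l .of_discrete).inter
      (measurable_regShift l hB))
  rw [← measure_iUnion]
  · refine measure_congr ?_
    filter_upwards [annealed_exists_regAt hP hnn] with X hX
    refine propext ⟨fun h => ?_, fun h => ?_⟩
    · have := (regTime_spec (hX h.1.2)).1
      exact Set.mem_iUnion.2 ⟨regTime l X - 1, h, by simp; omega⟩
    · exact (Set.mem_iUnion.1 h).choose_spec.1
  · intro n m hnm
    refine Set.disjoint_left.2 ?_
    rintro X ⟨-, h1⟩ ⟨-, h2⟩
    have h1 : regTime l X = n + 1 := h1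
    have h2 : regTime l X = m + 1 := h2
    omega
  · exact fun n => hmeas.inter (measurable_regTime l .of_discrete)

lemma isProbabilityMeasure_regLaw (hpos : annealed P (good l) ≠ 0) :
    IsProbabilityMeasure (regLaw P l) := cond_isProbabilityMeasure hpos

lemma regLaw_block_inter (hP : IID P) (hpos : annealed P (good l) ≠ 0) (U : Set (ℕ × Site d))
    {B : Set (Path d)} (hB : MeasurableSet B) :
    regLaw P l (block l ⁻¹' U ∩ regShift l ⁻¹' B) = regLaw P l (block l ⁻¹' U) * regLaw P l B := by
  obtain ⟨c, hc⟩ := annealed_block_inter hP hpos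
  have hfin : annealed P (good l) ≠ ∞ := measure_ne_top _ _
  have h1 := hc U Set.univ .univ
  rw [Set.preimage_univ, Set.inter_univ, Set.inter_univ] at h1
  simp only [regLaw, cond_apply (measurableSet_good l)]
  rw [hc U B hB, h1, mul_comm (c U) (annealed P (good l)),
    ENNReal.inv_mul_cancel_left hpos hfin, mul_left_comm]

lemma measurePreserving_regShift (hP : IID P) (hpos : annealed P (good l) ≠ 0) :
    MeasurePreserving (regShift l) (regLaw P l) (regLaw P l) := by
  have := isProbabilityMeasure_regLaw hpos
  refine ⟨measurable_regShift l, Measure.ext fun B hB => ?_⟩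
  have := regLaw_block_inter hP hpos Set.univ hB
  rw [Set.preimage_univ, Set.univ_inter, measure_univ, one_mul] at this
  rw [Measure.map_apply (measurable_regShift l) hB, this]

lemma indepFun_block_regShift (hP : IID P) (hpos : annealed P (good l) ≠ 0) :
    IndepFun (block l) (regShift l) (regLaw P l) := by
  rw [indepFun_iff_measure_inter_preimage_eq_mul]
  intro U B _ hB
  rw [regLaw_block_inter hP hpos U hB, (measurePreserving_regShift hP hpos).measure_preimage
    hB.nullMeasurableSet]

lemma identDistrib_block (hP : IID P) (hpos : annealed P (good l) ≠ 0) (i : ℕ) :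
    IdentDistrib (fun X => block l ((regShift l)^[i] X)) (block l) (regLaw P l) (regLaw P l) := by
  have hmp := (measurePreserving_regShift hP hpos).iterate i
  refine ⟨((measurable_block l).comp hmp.measurable).aemeasurable,
    (measurable_block l).aemeasurable, ?_⟩
  change (regLaw P l).map (block l ∘ (regShift l)^[i]) = _
  rw [← Measure.map_map (measurable_block l) hmp.measurable, hmp.map_eq]

lemma pairwise_indepFun_block (hP : IID P) (hpos : annealed P (good l) ≠ 0) :
    Pairwise fun i j => IndepFun (fun X => block l ((regShift l)^[i] X))
      (fun X => block l ((regShift l)^[j] X)) (regLaw P l) := by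
  have key : ∀ i k, IndepFun (fun X => block l ((regShift l)^[i] X))
      (fun X => block l ((regShift l)^[k + 1 + i] X)) (regLaw P l) := by
    intro i k
    have hmp := (measurePreserving_regShift hP hpos).iterate i
    have h1 : IndepFun (block l) (fun X => block l ((regShift l)^[k] (regShift l X)))
        (regLaw P l) := (indepFun_block_regShift hP hpos).comp measurable_id
      ((measurable_block l).comp ((measurable_regShift l).iterate k))
    rw [indepFun_iff_measure_inter_preimage_eq_mul] at h1 ⊢
    intro U V hU hV
    have h2 := h1 U V hU hV
    have hmU : MeasurableSet (block l ⁻¹' U) := measurable_block l hU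
    have hmV : MeasurableSet ((fun X => block l ((regShift l)^[k] (regShift l X))) ⁻¹' V) :=
      ((measurable_block l).comp (((measurable_regShift l).iterate k).comp
        (measurable_regShift l))) hV
    rw [← hmp.measure_preimage (hmU.inter hmV).nullMeasurableSet,
      ← hmp.measure_preimage hmU.nullMeasurableSet,
      ← hmp.measure_preimage hmV.nullMeasurableSet] at h2
    simp only [← Set.preimage_comp, Set.preimage_inter, Function.comp_def] at h2
    simp only [Function.iterate_add_apply, Function.iterate_one]
    exact h2
  intro i j hij
  rcases lt_or_gt_of_ne hij with h | h
  · obtain ⟨k, rfl⟩ := Nat.exists_eq_add_of_lt h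
    have := key i k
    rwa [show k + 1 + i = i + k + 1 by ring] at this
  · obtain ⟨k, rfl⟩ := Nat.exists_eq_add_of_lt h
    have := (key j k).symm
    rwa [show k + 1 + j = j + k + 1 by ring] at this

end Regeneration

/-! ### The height gained between regeneration times is integrable -/

/-- Good trajectories whose regeneration times after time `0` all occur at height `r` or above. -/
def regAbove (l : EuclideanSpace ℝ (Fin d)) (r : ℝ) : Set (Path d) :=
  good l ∩ {X | ∀ m, 1 ≤ m → X ∈ regAt l m → r ≤ ht l (X m)}

/-- Trajectories that stay nonnegative and reach height `a` for the first time at time `n`. -/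
def hitAt (l : EuclideanSpace ℝ (Fin d)) (a : ℝ) (n : ℕ) : Set (Path d) :=
  {X | (∀ m < n, ht l (X m) < a) ∧ a ≤ ht l (X n) ∧ ∀ m ≤ n, 0 ≤ ht l (X m)}

lemma measurableSet_regAbove (l : EuclideanSpace ℝ (Fin d)) (r : ℝ) :
    MeasurableSet (regAbove l r) := by
  have : regAbove l r = good l ∩ ⋂ m, {X | 1 ≤ m → X ∈ regAt l m → r ≤ ht l (X m)} := by
    ext X; simp [regAbove]
  rw [this]
  refine (measurableSet_good l).inter (.iInter fun m => ?_)
  exact .imp (.const _) (.imp (measurableSet_regAt l m)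
    (measurableSet_le measurable_const (measurable_ht_apply l m)))

lemma determinedBy_hitAt (l : EuclideanSpace ℝ (Fin d)) (a : ℝ) (n : ℕ) :
    DeterminedBy n (hitAt l a n) := by
  rintro X Y h ⟨h1, h2, h3⟩
  exact ⟨fun m hm => h m hm.le ▸ h1 m hm, h n le_rfl ▸ h2, fun m hm => h m hm ▸ h3 m hm⟩

lemma hitAt_subset_strictMax (l : EuclideanSpace ℝ (Fin d)) (a : ℝ) (n : ℕ) :
    hitAt l a n ⊆ strictMax l n := fun _ hX m hm => (hX.1 m hm).trans_le hX.2.1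

lemma disjoint_hitAt (l : EuclideanSpace ℝ (Fin d)) (a : ℝ) :
    Pairwise (Function.onFun Disjoint (hitAt (d := d) l a)) := by
  have : ∀ n m, n < m → Disjoint (hitAt (d := d) l a n) (hitAt l a m) := by
    intro n m hnm
    rw [Set.disjoint_left]
    rintro X ⟨-, h2, -⟩ ⟨h3, -, -⟩
    exact absurd (h3 n hnm) (not_lt.2 h2)
  intro n m hnm
  rcases lt_or_gt_of_ne hnm with h | h
  · exact this n m h
  · exact (this m n h).symm

lemma good_subset_iUnion_hitAt (l : EuclideanSpace ℝ (Fin d)) (a : ℝ) :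
    good l ⊆ ⋃ n, hitAt l a n := by
  classical
  rintro X ⟨hX0, hXt⟩
  have hex : ∃ n, a ≤ ht l (X n) := (hXt.eventually_ge_atTop a).exists
  refine Set.mem_iUnion.2 ⟨Nat.find hex, fun m hm => ?_, Nat.find_spec hex, fun m _ => hX0 m⟩
  exact not_le.1 (Nat.find_min hex hm)

/-- The point where a level is first reached is a regeneration point, and the next regeneration
occurs at least `r` higher. -/
def levelReg (l : EuclideanSpace ℝ (Fin d)) (a r : ℝ) : Set (Path d) :=
  ⋃ n, hitAt l a n ∩ post n ⁻¹' regAbove l r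

lemma measurableSet_levelReg (l : EuclideanSpace ℝ (Fin d)) (a r : ℝ) :
    MeasurableSet (levelReg l a r) :=
  .iUnion fun n => (determinedBy_hitAt l a n).measurableSet.inter
    (measurable_post n (measurableSet_regAbove l r))

lemma exists_step_bound (l : EuclideanSpace ℝ (Fin d)) :
    ∃ K : ℝ, 0 < K ∧ ∀ e : Dir d, ht l e.vec < K := by
  obtain ⟨b, hb⟩ := (Set.finite_range fun e : Dir d => ht l e.vec).bddAbove
  refine ⟨max b 0 + 1, by positivity, fun e => ?_⟩
  have : ht l e.vec ≤ b := hb ⟨e, rfl⟩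
  have := le_max_left b 0
  linarith

lemma le_annealed_levelReg {P : Measure (Env d)} [IsProbabilityMeasure P] (hP : IID P)
    (l : EuclideanSpace ℝ (Fin d)) (a r : ℝ) :
    annealed P (good l) * annealed P (regAbove l r) ≤ annealed P (levelReg l a r) := by
  rw [levelReg, measure_iUnion]
  · simp_rw [annealed_strictMax_inter_post hP (determinedBy_hitAt l a _)
      (hitAt_subset_strictMax l a _) (measurableSet_regAbove l r) fun X hX => hX.1.1]
    rw [ENNReal.tsum_mul_right,
      ← measure_iUnion (disjoint_hitAt l a) fun n => (determinedBy_hitAt l a n).measurableSet]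
    gcongr
    exact good_subset_iUnion_hitAt l a
  · exact fun n m hnm => (disjoint_hitAt l a hnm).mono Set.inter_subset_left Set.inter_subset_left
  · exact fun n => (determinedBy_hitAt l a n).measurableSet.inter
      (measurable_post n (measurableSet_regAbove l r))

lemma disjoint_levelReg {l : EuclideanSpace ℝ (Fin d)} {K : ℝ} (hK : 0 < K)
    (hstep : ∀ e : Dir d, ht l e.vec < K) {N i j : ℕ} (hij : i < j) (hj : j < N) :
    Disjoint (levelReg l (i * K) ((N - i) * K) ∩ nnPaths d)
      (levelReg l (j * K) ((N - j) * K) ∩ nnPaths d) := by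
  have hhit : ∀ (k n : ℕ) (X : Path d), X ∈ nnPaths d → X ∈ hitAt l (k * K) n →
      ht l (X n) < (k + 1) * K := by
    rintro k n X ⟨hX0, hnn⟩ ⟨h1, -, -⟩
    rcases n with _ | n
    · rw [hX0, ht_zero]
      positivity
    · obtain ⟨e, he⟩ := hnn n
      rw [he, ht_add]
      have := h1 n n.lt_succ_self
      have := hstep e
      linarith
  rw [Set.disjoint_left]
  rintro X ⟨hXi, hnn⟩ ⟨hXj, -⟩
  obtain ⟨n, hn, hn'⟩ := Set.mem_iUnion.1 hXi
  obtain ⟨m, hm, hm'⟩ := Set.mem_iUnion.1 hXj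
  have h1 := hhit i n X hnn hn
  have h2 := hhit j m X hnn hm
  have hij' : (i : ℝ) + 1 ≤ j := by exact_mod_cast hij
  have hjN : (j : ℝ) + 1 ≤ N := by exact_mod_cast hj
  have h3 : ((i : ℝ) + 1) * K ≤ j * K := by gcongr
  have h4 : ((j : ℝ) + 1) * K ≤ N * K := by gcongr
  have hnm : n < m := by
    by_contra hcon
    rcases eq_or_lt_of_le (not_lt.1 hcon) with h | h
    · subst h
      have := hm.2.1
      linarith
    · have h5 := hn.1 m h
      have h6 := hm.2.1
      have : (i : ℝ) * K ≤ j * K := by linarith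
      linarith
  obtain ⟨k, rfl⟩ := Nat.exists_eq_add_of_le hnm.le
  have hreg : post n X ∈ regAt l k := by
    refine ⟨fun m' hm'k => ?_, ?_⟩
    · simp only [post, ht_sub]
      have := hitAt_subset_strictMax l _ _ hm (n + m') (by omega)
      linarith
    · rw [Set.mem_preimage, post_post]
      exact hm'.1.1
  have := hn'.2 k (by omega) hreg
  simp only [post, ht_sub] at this
  have h7 := hn.2.1
  linarith

lemma sum_annealed_regAbove_le {P : Measure (Env d)} [IsProbabilityMeasure P] (hP : IID P)
    {l : EuclideanSpace ℝ (Fin d)} {K : ℝ} (hK : 0 < K) (hstep : ∀ e : Dir d, ht l e.vec < K)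
    (N : ℕ) :
    annealed P (good l) * ∑ i ∈ Finset.range N, annealed P (regAbove l ((i + 1 : ℕ) * K)) ≤ 1 := by
  have hnn : ∀ s : Set (Path d), annealed P (s ∩ nnPaths d) = annealed P s := fun s =>
    measure_congr (by
      filter_upwards [annealed_nnPaths P] with X hX
      exact propext ⟨fun h => h.1, fun h => ⟨h, hX⟩⟩)
  calc annealed P (good l) * ∑ i ∈ Finset.range N, annealed P (regAbove l ((i + 1 : ℕ) * K))
      = ∑ j ∈ Finset.range N, annealed P (good l) * annealed P (regAbove l ((N - j : ℝ) * K)) := by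
        rw [Finset.mul_sum, ← Finset.sum_range_reflect]
        refine Finset.sum_congr rfl fun j hj => ?_
        have hj' := Finset.mem_range.1 hj
        have : N - 1 - j + 1 = N - j := by omega
        rw [this, Nat.cast_sub hj'.le]
    _ ≤ ∑ j ∈ Finset.range N, annealed P (levelReg l (j * K) ((N - j) * K) ∩ nnPaths d) :=
        Finset.sum_le_sum fun j _ => by
          rw [hnn]
          exact le_annealed_levelReg hP l _ _
    _ = annealed P (⋃ j ∈ Finset.range N, levelReg l (j * K) ((N - j) * K) ∩ nnPaths d) := by
        refine (measure_biUnion_finset ?_ fun j _ =>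
          (measurableSet_levelReg l _ _).inter measurableSet_nnPaths).symm
        intro i hi j hj hij
        rw [Finset.coe_range, Set.mem_Iio] at hi hj
        rcases lt_or_gt_of_ne hij with h | h
        · exact disjoint_levelReg hK hstep h hj
        · exact (disjoint_levelReg hK hstep h hi).symm
    _ ≤ 1 := prob_le_one

lemma mem_regAbove {l : EuclideanSpace ℝ (Fin d)} {X : Path d} (hX : X ∈ good l)
    (hreg : ∃ n, 1 ≤ n ∧ X ∈ regAt l n) {r : ℝ} (hr : r ≤ ht l (X (regTime l X))) :
    X ∈ regAbove l r := by
  refine ⟨hX, fun m hm hXm => ?_⟩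
  have h1 := (regTime_spec hreg).2
  have h2 : regTime l X ≤ m := Nat.sInf_le ⟨hm, hXm⟩
  rcases h2.eq_or_lt with h | h
  · rwa [← h]
  · exact hr.trans (hXm.1 _ h).le

lemma integrable_ht_regTime {P : Measure (Env d)} [IsProbabilityMeasure P] (hP : IID P)
    {l : EuclideanSpace ℝ (Fin d)} (hpos : annealed P (good l) ≠ 0) :
    Integrable (fun X => ht l (X (regTime l X))) (regLaw P l) := by
  obtain ⟨K, hK, hstep⟩ := exists_step_bound l
  have hnn : annealed P (nonneg l) ≠ 0 := fun h0 =>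
    hpos (measure_mono_null Set.inter_subset_left h0)
  have hprob := isProbabilityMeasure_regLaw hpos
  have hmeas : Measurable fun X : Path d => ht l (X (regTime l X)) :=
    (Measurable.of_discrete (f := ht l)).comp (measurable_snd.comp (measurable_block l))
  have hnonneg : ∀ᵐ X ∂(regLaw P l), 0 ≤ ht l (X (regTime l X)) := by
    filter_upwards [ae_regLaw_good] with X hX
    exact hX.1 _
  refine ⟨hmeas.aestronglyMeasurable, ?_⟩
  rw [hasFiniteIntegral_iff_ofReal hnonneg]
  have hset : ∀ i : ℕ, MeasurableSet {X : Path d | (i : ℝ) * K ≤ ht l (X (regTime l X))} :=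
    fun i => measurableSet_le measurable_const hmeas
  have hbound : ∀ X : Path d, ENNReal.ofReal (ht l (X (regTime l X))) ≤ ENNReal.ofReal K *
      ∑' i : ℕ, {X : Path d | (i : ℝ) * K ≤ ht l (X (regTime l X))}.indicator
        (fun _ => (1 : ℝ≥0∞)) X := by
    intro X
    set t := ht l (X (regTime l X)) with ht'
    rcases le_or_gt t 0 with h0 | h0
    · rw [ENNReal.ofReal_of_nonpos h0]; exact zero_le
    set m := ⌊t / K⌋₊ with hm
    have h1 : t ≤ K * (m + 1 : ℕ) := by
      have := (Nat.lt_floor_add_one (t / K)).le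
      rw [div_le_iff₀ hK] at this
      push_cast
      linarith
    calc ENNReal.ofReal t ≤ ENNReal.ofReal (K * (m + 1 : ℕ)) := ENNReal.ofReal_le_ofReal h1
      _ = ENNReal.ofReal K * ∑ i ∈ Finset.range (m + 1), 1 := by
        rw [ENNReal.ofReal_mul hK.le, ENNReal.ofReal_natCast]; simp
      _ = ENNReal.ofReal K * ∑ i ∈ Finset.range (m + 1),
          {X : Path d | (i : ℝ) * K ≤ ht l (X (regTime l X))}.indicator
            (fun _ => (1 : ℝ≥0∞)) X := by
        congr 1
        refine Finset.sum_congr rfl fun i hi => ?_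
        rw [Set.indicator_of_mem]
        have hi' : i ≤ m := Nat.lt_succ_iff.1 (Finset.mem_range.1 hi)
        have h2 : (i : ℝ) ≤ t / K := (Nat.cast_le.2 hi').trans (Nat.floor_le (by positivity))
        exact (le_div_iff₀ hK).1 h2
      _ ≤ _ := by gcongr; exact ENNReal.sum_le_tsum _
  refine (lintegral_mono hbound).trans_lt ?_
  rw [lintegral_const_mul' _ _ ENNReal.ofReal_ne_top,
    lintegral_tsum fun i => (measurable_const.indicator (hset i)).aemeasurable]
  refine ENNReal.mul_lt_top ENNReal.ofReal_lt_top ?_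
  simp_rw [lintegral_indicator_const (hset _), one_mul]
  rw [tsum_eq_zero_add' ENNReal.summable]
  refine ENNReal.add_lt_top.2 ⟨measure_lt_top _ _, ?_⟩
  have hle : ∀ i : ℕ, regLaw P l {X : Path d | ((i + 1 : ℕ) : ℝ) * K ≤ ht l (X (regTime l X))} ≤
      (annealed P (good l))⁻¹ * annealed P (regAbove l ((i + 1 : ℕ) * K)) := by
    intro i
    rw [regLaw, cond_apply (measurableSet_good l)]
    refine mul_le_mul' le_rfl (measure_mono_ae ?_)
    filter_upwards [annealed_exists_regAt hP hnn] with X hX hXm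
    exact mem_regAbove hXm.1 (hX hXm.1.2) hXm.2
  refine (ENNReal.tsum_le_tsum hle).trans_lt ?_
  rw [ENNReal.tsum_mul_left]
  refine ENNReal.mul_lt_top (ENNReal.inv_lt_top.2 (pos_iff_ne_zero.2 hpos)) ?_
  refine lt_of_le_of_lt (b := (annealed P (good l))⁻¹) ?_
    (ENNReal.inv_lt_top.2 (pos_iff_ne_zero.2 hpos))
  refine ENNReal.tsum_le_of_sum_range_le fun N => ?_
  rw [← one_div, ENNReal.le_div_iff_mul_le (Or.inl hpos) (Or.inl (measure_ne_top _ _)), mul_comm]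
  exact sum_annealed_regAbove_le hP hK hstep N

/-! ### Deterministic interpolation between renewal times -/

lemma exists_renewal_index {T : ℕ → ℕ} (h0 : T 0 = 0) (hT : StrictMono T) :
    ∃ k : ℕ → ℕ, Tendsto k atTop atTop ∧ ∀ n, T (k n) ≤ n ∧ n < T (k n + 1) := by
  have key : ∀ n, ∃ k, T k ≤ n ∧ n < T (k + 1) := by
    intro n
    induction n with
    | zero => exact ⟨0, h0.le, (Nat.zero_le _).trans_lt (hT Nat.zero_lt_one)⟩
    | succ n ih =>
      obtain ⟨k, hk, hk'⟩ := ih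
      rcases (Nat.succ_le_of_lt hk').eq_or_lt with h | h
      · refine ⟨k + 1, h.ge, ?_⟩
        have := hT (Nat.lt_succ_self (k + 1))
        simp only [Nat.succ_eq_add_one] at h this
        omega
      · exact ⟨k, by omega, h⟩
  choose k hk hk' using key
  refine ⟨k, tendsto_atTop.2 fun M => ?_, fun n => ⟨hk n, hk' n⟩⟩
  filter_upwards [eventually_ge_atTop (T M)] with n hn
  have : M < k n + 1 := hT.lt_iff_lt.1 (hn.trans_lt (hk' n))
  omega

lemma tendsto_add_one_div {k : ℕ → ℕ} {κ : ℝ}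
    (h : Tendsto (fun n => (k n : ℝ) / n) atTop (𝓝 κ)) :
    Tendsto (fun n => ((k n + 1 : ℕ) : ℝ) / n) atTop (𝓝 κ) := by
  have := h.add tendsto_one_div_atTop_nhds_zero_nat
  rw [add_zero] at this
  refine this.congr fun n => ?_
  push_cast
  ring

lemma tendsto_index_div_of_tendsto {T k : ℕ → ℕ} (hk : Tendsto k atTop atTop)
    (hT : ∀ n, T (k n) ≤ n ∧ n < T (k n + 1)) {t : ℝ} (ht : 0 < t)
    (hlim : Tendsto (fun j => (T j : ℝ) / j) atTop (𝓝 t)) :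
    Tendsto (fun n => (k n : ℝ) / n) atTop (𝓝 t⁻¹) := by
  have hupper : Tendsto (fun n => (T (k n + 1) : ℝ) / k n) atTop (𝓝 t) := by
    have h1 : Tendsto (fun j : ℕ => (T (j + 1) : ℝ) / (j + 1 : ℕ) * (1 + 1 / (j : ℝ))) atTop
        (𝓝 (t * (1 + 0))) :=
      ((tendsto_add_atTop_iff_nat 1).2 hlim).mul
        (tendsto_const_nhds.add tendsto_one_div_atTop_nhds_zero_nat)
    rw [add_zero, mul_one] at h1
    refine (h1.comp hk).congr' ?_
    filter_upwards [hk.eventually_ge_atTop 1] with n hn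
    have : (0 : ℝ) < k n := by exact_mod_cast hn
    simp only [Function.comp]
    push_cast
    field_simp
  have hmid : Tendsto (fun n : ℕ => (n : ℝ) / k n) atTop (𝓝 t) := by
    refine tendsto_of_tendsto_of_tendsto_of_le_of_le (hlim.comp hk) hupper ?_ ?_
    · intro n
      have : (T (k n) : ℝ) ≤ n := by exact_mod_cast (hT n).1
      simp only [Function.comp]
      gcongr
    · intro n
      have : (n : ℝ) ≤ T (k n + 1) := by exact_mod_cast (hT n).2.le
      simp only
      gcongr
  refine (hmid.inv₀ ht.ne').congr fun n => ?_
  rw [inv_div]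

lemma tendsto_index_div_of_tendsto_atTop {T k : ℕ → ℕ} (hk : Tendsto k atTop atTop)
    (hT : ∀ n, T (k n) ≤ n) (hlim : Tendsto (fun j => (T j : ℝ) / j) atTop atTop) :
    Tendsto (fun n => (k n : ℝ) / n) atTop (𝓝 0) := by
  have hmid : Tendsto (fun n : ℕ => (n : ℝ) / k n) atTop atTop := by
    refine tendsto_atTop_mono (fun n => ?_) (hlim.comp hk)
    have : (T (k n) : ℝ) ≤ n := by exact_mod_cast hT n
    simp only [Function.comp]
    gcongr
  refine hmid.inv_tendsto_atTop.congr fun n => ?_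
  simp

lemma tendsto_of_renewal_linear {E : Type*} [NormedAddCommGroup E] [NormedSpace ℝ E]
    {x : ℕ → E} (hx : ∀ m n, ‖x (m + n) - x m‖ ≤ n) {T : ℕ → ℕ} (h0 : T 0 = 0)
    (hT : StrictMono T) {t : ℝ} (ht : 0 < t)
    (hlim : Tendsto (fun j => (T j : ℝ) / j) atTop (𝓝 t)) {m : E}
    (hm : Tendsto (fun j : ℕ => (j : ℝ)⁻¹ • x (T j)) atTop (𝓝 m)) :
    Tendsto (fun n : ℕ => (n : ℝ)⁻¹ • x n) atTop (𝓝 (t⁻¹ • m)) := by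
  obtain ⟨k, hk, hkT⟩ := exists_renewal_index h0 hT
  have hκ := tendsto_index_div_of_tendsto hk hkT ht hlim
  have h1 : Tendsto (fun n : ℕ => ((k n : ℝ) / n) • ((k n : ℝ)⁻¹ • x (T (k n)))) atTop
      (𝓝 (t⁻¹ • m)) := hκ.smul (hm.comp hk)
  have h2 : Tendsto (fun n : ℕ => 1 - (T (k n) : ℝ) / k n * ((k n : ℝ) / n)) atTop (𝓝 0) := by
    have := (hlim.comp hk).mul hκ
    rw [mul_inv_cancel₀ ht.ne'] at this
    have h := (tendsto_const_nhds (x := (1 : ℝ))).sub this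
    rwa [sub_self] at h
  have h3 : Tendsto (fun n : ℕ => (n : ℝ)⁻¹ • (x n - x (T (k n)))) atTop (𝓝 0) := by
    refine squeeze_zero_norm' ?_ h2
    filter_upwards [hk.eventually_ge_atTop 1, eventually_ge_atTop 1] with n hn hn'
    have hk0 : (0 : ℝ) < k n := by exact_mod_cast hn
    have hn0 : (0 : ℝ) < n := by exact_mod_cast hn'
    obtain ⟨j, hj⟩ := Nat.exists_eq_add_of_le (hkT n).1
    have h4 := hx (T (k n)) j
    rw [← hj] at h4
    have h5 : (n : ℝ) = T (k n) + j := by exact_mod_cast hj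
    rw [norm_smul, norm_inv, Real.norm_natCast]
    calc (n : ℝ)⁻¹ * ‖x n - x (T (k n))‖ ≤ (n : ℝ)⁻¹ * j := by gcongr
      _ = 1 - (T (k n) : ℝ) / k n * ((k n : ℝ) / n) := by
        rw [show (j : ℝ) = n - T (k n) by linarith]
        field_simp
  have h6 := h3.add h1
  rw [zero_add] at h6
  refine h6.congr' ?_
  filter_upwards [hk.eventually_ge_atTop 1] with n hn
  have hk0 : (k n : ℝ) ≠ 0 := by
    have : (0 : ℝ) < k n := by exact_mod_cast hn
    exact this.ne'
  rw [smul_smul, div_mul_eq_mul_div, mul_inv_cancel₀ hk0, one_div, ← smul_add, sub_add_cancel]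

lemma tendsto_of_renewal_superlinear {y : ℕ → ℝ} {T : ℕ → ℕ} (h0 : T 0 = 0) (hT : StrictMono T)
    (hy0 : ∀ n, 0 ≤ y n) (hy : ∀ j n, T j ≤ n → n < T (j + 1) → y n ≤ y (T (j + 1)))
    (hlim : Tendsto (fun j => (T j : ℝ) / j) atTop atTop) {ρ : ℝ}
    (hρ : Tendsto (fun j : ℕ => y (T j) / j) atTop (𝓝 ρ)) :
    Tendsto (fun n : ℕ => (n : ℝ)⁻¹ • y n) atTop (𝓝 0) := by
  obtain ⟨k, hk, hkT⟩ := exists_renewal_index h0 hT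
  have hκ := tendsto_add_one_div (tendsto_index_div_of_tendsto_atTop hk (fun n => (hkT n).1) hlim)
  have h1 := (((tendsto_add_atTop_iff_nat 1).2 hρ).comp hk).mul hκ
  rw [mul_zero] at h1
  refine squeeze_zero (fun n => by have := hy0 n; positivity) (fun n => ?_) h1
  have h2 := hy (k n) n (hkT n).1 (hkT n).2
  have h3 : ((k n + 1 : ℕ) : ℝ) ≠ 0 := by positivity
  simp only [Function.comp, smul_eq_mul]
  rw [div_mul_div_cancel₀ h3, inv_mul_eq_div]
  gcongr

lemma tendsto_inv_smul_of_shift {E : Type*} [NormedAddCommGroup E] [NormedSpace ℝ E]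
    {x : ℕ → E} {v : E} (m : ℕ)
    (h : Tendsto (fun n : ℕ => (n : ℝ)⁻¹ • (x (m + n) - x m)) atTop (𝓝 v)) :
    Tendsto (fun n : ℕ => (n : ℝ)⁻¹ • x n) atTop (𝓝 v) := by
  rw [← tendsto_add_atTop_iff_nat m]
  have h1 : Tendsto (fun n : ℕ => (n : ℝ) / (n + m : ℝ)) atTop (𝓝 1) :=
    tendsto_natCast_div_add_atTop (m : ℝ)
  have h2 : Tendsto (fun n : ℕ => ((n + m : ℕ) : ℝ)⁻¹) atTop (𝓝 0) :=
    (tendsto_inv_atTop_zero.comp tendsto_natCast_atTop_atTop).comp (tendsto_add_atTop_nat m)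
  have h3 := (h1.smul h).add (h2.smul_const (x m))
  rw [one_smul, zero_smul, add_zero] at h3
  refine h3.congr' ?_
  filter_upwards [eventually_ge_atTop 1] with n hn
  have hn0 : (n : ℝ) ≠ 0 := by
    have : (0 : ℝ) < n := by exact_mod_cast hn
    exact this.ne'
  rw [smul_smul, div_mul_eq_mul_div, mul_inv_cancel₀ hn0, one_div, Nat.cast_add, ← smul_add,
    add_comm n m, sub_add_cancel]

/-! ### A law of large numbers for nonintegrable nonnegative variables -/

lemma tendsto_integral_min_atTop {Ω : Type*} {m : MeasurableSpace Ω} {μ : Measure Ω}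
    [IsProbabilityMeasure μ] {f : Ω → ℝ} (hf : Measurable f) (hf0 : ∀ x, 0 ≤ f x)
    (hint : ¬ Integrable f μ) (L : ℝ) : ∃ M : ℕ, L < ∫ x, min (f x) M ∂μ := by
  have htop : ∫⁻ x, ENNReal.ofReal (f x) ∂μ = ∞ := by
    by_contra h
    exact hint ⟨hf.aestronglyMeasurable,
      (hasFiniteIntegral_iff_ofReal (ae_of_all _ hf0)).2 (lt_top_iff_ne_top.2 h)⟩
  have hmin0 : ∀ (M : ℕ) x, 0 ≤ min (f x) M := fun M x => le_min (hf0 x) (Nat.cast_nonneg M)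
  have hlim : Tendsto (fun M : ℕ => ∫⁻ x, ENNReal.ofReal (min (f x) M) ∂μ) atTop
      (𝓝 (∫⁻ x, ENNReal.ofReal (f x) ∂μ)) := by
    refine lintegral_tendsto_of_tendsto_of_monotone
      (fun M => (hf.min measurable_const).ennreal_ofReal.aemeasurable)
      (ae_of_all _ fun x M M' hM => ?_) (ae_of_all _ fun x => ?_)
    · refine ENNReal.ofReal_le_ofReal (min_le_min_left _ ?_)
      exact_mod_cast hM
    · refine tendsto_const_nhds.congr' ?_
      filter_upwards [eventually_ge_atTop ⌈f x⌉₊] with M hM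
      rw [min_eq_left (Nat.ceil_le.1 hM)]
  rw [htop] at hlim
  obtain ⟨M, hM⟩ := (hlim.eventually_const_lt (ENNReal.ofReal_lt_top (r := L))).exists
  refine ⟨M, ?_⟩
  have hi : Integrable (fun x => min (f x) M) μ := by
    refine Integrable.of_bound (hf.min measurable_const).aestronglyMeasurable M
      (ae_of_all _ fun x => ?_)
    rw [Real.norm_of_nonneg (hmin0 M x)]
    exact min_le_right _ _
  rw [← ofReal_integral_eq_lintegral_ofReal hi (ae_of_all _ (hmin0 M))] at hM
  exact lt_of_not_ge fun hle => absurd hM (not_lt.2 (ENNReal.ofReal_le_ofReal hle))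

lemma strong_law_ae_atTop {Ω : Type*} {m : MeasurableSpace Ω} {μ : Measure Ω}
    [IsProbabilityMeasure μ] {X : ℕ → Ω → ℝ} (hX : ∀ i, Measurable (X i))
    (hX0 : ∀ i ω, 0 ≤ X i ω) (hint : ¬ Integrable (X 0) μ)
    (hindep : Pairwise fun i j => IndepFun (X i) (X j) μ)
    (hident : ∀ i, IdentDistrib (X i) (X 0) μ μ) :
    ∀ᵐ ω ∂μ, Tendsto (fun n : ℕ => (∑ i ∈ Finset.range n, X i ω) / n) atTop atTop := by
  have hmin : ∀ M : ℕ, Measurable fun t : ℝ => min t M := fun M => measurable_id.min measurable_const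
  have key : ∀ M : ℕ, ∀ᵐ ω ∂μ, Tendsto (fun n : ℕ => (∑ i ∈ Finset.range n, min (X i ω) M) / n)
      atTop (𝓝 (∫ ω, min (X 0 ω) M ∂μ)) := by
    intro M
    refine strong_law_ae_real (fun i ω => min (X i ω) M) ?_ ?_ ?_
    · refine Integrable.of_bound ((hX 0).min measurable_const).aestronglyMeasurable M
        (ae_of_all _ fun x => ?_)
      rw [Real.norm_of_nonneg (le_min (hX0 0 x) (Nat.cast_nonneg M))]
      exact min_le_right _ _
    · intro i j hij
      exact (hindep hij).comp (hmin M) (hmin M)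
    · intro i
      exact (hident i).comp (hmin M)
  filter_upwards [ae_all_iff.2 key] with ω hω
  refine tendsto_atTop.2 fun L => ?_
  obtain ⟨M, hM⟩ := tendsto_integral_min_atTop (hX 0) (hX0 0) hint L
  filter_upwards [(hω M).eventually_const_lt hM] with n hn
  refine hn.le.trans ?_
  gcongr
  exact min_le_left _ _

/-! ### Renewal structure of a single trajectory -/

lemma norm_toEuclid_vec (e : Dir d) : ‖toEuclid e.vec‖ = 1 := by
  have h : toEuclid e.vec = EuclideanSpace.single e.1 ((e.2 : ℤ) : ℝ) := by
    ext j
    by_cases hj : j = e.1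
    · subst hj; simp [toEuclid, Dir.vec]
    · simp [toEuclid, Dir.vec, hj]
  rw [h, PiLp.norm_single]
  rcases Int.isUnit_iff.1 e.2.isUnit with h | h <;> simp [h]

lemma norm_sub_le_of_mem_nnPaths {X : Path d} (hX : X ∈ nnPaths d) (m n : ℕ) :
    ‖toEuclid (X (m + n)) - toEuclid (X m)‖ ≤ n := by
  induction n with
  | zero => simp
  | succ n ih =>
    obtain ⟨e, he⟩ := hX.2 (m + n)
    rw [← add_assoc, he, toEuclid_add, add_sub_right_comm]
    refine (norm_add_le _ _).trans ?_
    rw [norm_toEuclid_vec]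
    push_cast
    gcongr

/-- The `k`-th regeneration time. -/
noncomputable def regSum (l : EuclideanSpace ℝ (Fin d)) (X : Path d) (k : ℕ) : ℕ :=
  ∑ i ∈ Finset.range k, regTime l ((regShift l)^[i] X)

lemma iterate_regShift {l : EuclideanSpace ℝ (Fin d)} {X : Path d} (hX : X 0 = 0) (k : ℕ) :
    (regShift l)^[k] X = post (regSum l X k) X := by
  induction k with
  | zero =>
    funext j
    simp [post, regSum, hX]
  | succ k ih =>
    have h : regTime l ((regShift l)^[k] X) = regTime l (post (regSum l X k) X) := by rw [ih]
    rw [Function.iterate_succ_apply', regSum, Finset.sum_range_succ, h, ← regSum, ← post_post, ih]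
    rfl

lemma apply_regSum {l : EuclideanSpace ℝ (Fin d)} {X : Path d} (hX : X 0 = 0) (k : ℕ) :
    X (regSum l X k) = ∑ i ∈ Finset.range k, (block l ((regShift l)^[i] X)).2 := by
  induction k with
  | zero => simp [regSum, hX]
  | succ k ih =>
    have h : X (regSum l X (k + 1)) =
        X (regSum l X k) + (block l ((regShift l)^[k] X)).2 := by
      conv_lhs => rw [regSum, Finset.sum_range_succ, ← regSum]
      rw [iterate_regShift hX, block, post]
      simp
    rw [Finset.sum_range_succ, ← ih, h]

/-- Trajectories from the origin with infinitely many regeneration times. -/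
def renewing (l : EuclideanSpace ℝ (Fin d)) : Set (Path d) :=
  {X | X ∈ nnPaths d ∧
    ∀ i, (regShift l)^[i] X ∈ good l ∧ ∃ n, 1 ≤ n ∧ (regShift l)^[i] X ∈ regAt l n}

lemma strictMono_regSum {l : EuclideanSpace ℝ (Fin d)} {X : Path d} (hX : X ∈ renewing l) :
    StrictMono (regSum l X) := by
  refine strictMono_nat_of_lt_succ fun k => ?_
  have := (regTime_spec (hX.2 k).2).1
  rw [regSum, regSum, Finset.sum_range_succ]
  omega

lemma ht_le_of_lt_regSum {l : EuclideanSpace ℝ (Fin d)} {X : Path d} (hX : X ∈ renewing l)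
    {j n : ℕ} (h1 : regSum l X j ≤ n) (h2 : n < regSum l X (j + 1)) :
    ht l (X n) ≤ ht l (X (regSum l X (j + 1))) := by
  have hreg := (regTime_spec (hX.2 j).2).2
  have hT : regSum l X (j + 1) = regSum l X j + regTime l ((regShift l)^[j] X) := by
    rw [regSum, Finset.sum_range_succ, ← regSum]
  obtain ⟨m, rfl⟩ := Nat.exists_eq_add_of_le h1
  have := hreg.1 m (by omega)
  rw [iterate_regShift hX.1.1, post, post, ht_sub, ht_sub, ← iterate_regShift hX.1.1, ← hT] at this
  linarith

section Regeneration

variable {P : Measure (Env d)} [IsProbabilityMeasure P] {l : EuclideanSpace ℝ (Fin d)}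

lemma regLaw_renewing (hP : IID P) (hpos : annealed P (good l) ≠ 0) :
    ∀ᵐ X ∂(regLaw P l), X ∈ renewing l := by
  have hnn : annealed P (nonneg l) ≠ 0 := fun h0 =>
    hpos (measure_mono_null Set.inter_subset_left h0)
  have h1 : ∀ᵐ X ∂(regLaw P l), X ∈ good l ∧ ∃ n, 1 ≤ n ∧ X ∈ regAt l n := by
    filter_upwards [ae_regLaw_good, ae_regLaw_of_ae (annealed_exists_regAt hP hnn)] with X hX hX'
    exact ⟨hX, hX' hX.2⟩
  have h2 : ∀ᵐ X ∂(regLaw P l), ∀ i, (regShift l)^[i] X ∈ good l ∧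
      ∃ n, 1 ≤ n ∧ (regShift l)^[i] X ∈ regAt l n :=
    ae_all_iff.2 fun i =>
      ((measurePreserving_regShift hP hpos).iterate i).quasiMeasurePreserving.ae h1
  filter_upwards [h2, ae_regLaw_of_ae (annealed_nnPaths P)] with X hX hX'
  exact ⟨hX', hX⟩

/-- Law of large numbers from a regeneration time: either the walk has a velocity, or its speed in
direction `l` vanishes. -/
lemma regLaw_tendsto (hP : IID P) (hpos : annealed P (good l) ≠ 0) :
    (∃ v : EuclideanSpace ℝ (Fin d), ∀ᵐ X ∂(regLaw P l),
      Tendsto (fun n : ℕ => (n : ℝ)⁻¹ • toEuclid (X n)) atTop (𝓝 v)) ∨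
    ∀ᵐ X ∂(regLaw P l), Tendsto (fun n : ℕ => (n : ℝ)⁻¹ • ht l (X n)) atTop (𝓝 0) := by
  have hprob := isProbabilityMeasure_regLaw hpos
  have hren := regLaw_renewing hP hpos
  have hindep := pairwise_indepFun_block hP hpos
  have hident := identDistrib_block hP hpos
  have hfst : Measurable fun b : ℕ × Site d => (b.1 : ℝ) := .of_discrete
  have hsnd : Measurable fun b : ℕ × Site d => toEuclid b.2 := .of_discrete
  have hheight : Measurable fun b : ℕ × Site d => ht l b.2 := .of_discrete
  have hsum : ∀ (X : Path d) (k : ℕ), (∑ i ∈ Finset.range k,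
      ((block l ((regShift l)^[i] X)).1 : ℝ)) = regSum l X k := fun X k => by
    rw [regSum, Nat.cast_sum]; rfl
  by_cases hint : Integrable (fun X => ((block l X).1 : ℝ)) (regLaw P l)
  · left
    have hT := strong_law_ae_real
      (fun i X => ((block l ((regShift l)^[i] X)).1 : ℝ)) hint
      (fun i j hij => (hindep hij).comp hfst hfst) (fun i => (hident i).comp hfst)
    have hint2 : Integrable (fun X => toEuclid (block l X).2) (regLaw P l) := by
      refine hint.mono' (hsnd.comp (measurable_block l)).aestronglyMeasurable ?_
      filter_upwards [hren] with X hX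
      have := norm_sub_le_of_mem_nnPaths hX.1 0 (regTime l X)
      rwa [zero_add, hX.1.1, toEuclid_zero, sub_zero] at this
    have hV := strong_law_ae
      (fun i X => toEuclid (block l ((regShift l)^[i] X)).2) hint2
      (fun i j hij => (hindep hij).comp hsnd hsnd) (fun i => (hident i).comp hsnd)
    have ht0 : 0 < ∫ X, ((block l X).1 : ℝ) ∂(regLaw P l) := by
      have h1 : ∫ _, (1 : ℝ) ∂(regLaw P l) ≤ ∫ X, ((block l X).1 : ℝ) ∂(regLaw P l) := by
        refine integral_mono_ae (integrable_const _) hint ?_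
        filter_upwards [hren] with X hX
        exact_mod_cast (regTime_spec (hX.2 0).2).1
      rw [integral_const, probReal_univ, one_smul] at h1
      linarith
    refine ⟨(∫ X, ((block l X).1 : ℝ) ∂(regLaw P l))⁻¹ •
      ∫ X, toEuclid (block l X).2 ∂(regLaw P l), ?_⟩
    filter_upwards [hT, hV, hren] with X hXT hXV hX
    simp only [hsum] at hXT
    refine tendsto_of_renewal_linear (norm_sub_le_of_mem_nnPaths hX.1) (T := regSum l X)
      (by simp [regSum]) (strictMono_regSum hX) ht0 hXT (hXV.congr fun n => ?_)
    rw [apply_regSum hX.1.1]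
    congr 1
    exact (map_sum (AddMonoidHom.mk' toEuclid toEuclid_add) _ _).symm
  · right
    have hT := strong_law_ae_atTop (μ := regLaw P l)
      (X := fun i X => ((block l ((regShift l)^[i] X)).1 : ℝ))
      (fun i => hfst.comp ((measurable_block l).comp ((measurable_regShift l).iterate i)))
      (fun i X => Nat.cast_nonneg _) hint
      (fun i j hij => (hindep hij).comp hfst hfst) (fun i => (hident i).comp hfst)
    have hH := strong_law_ae_real
      (fun i X => ht l (block l ((regShift l)^[i] X)).2) (integrable_ht_regTime hP hpos)
      (fun i j hij => (hindep hij).comp hheight hheight) (fun i => (hident i).comp hheight)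
    filter_upwards [hT, hH, hren] with X hXT hXH hX
    simp only [hsum] at hXT
    refine tendsto_of_renewal_superlinear (T := regSum l X) (by simp [regSum])
      (strictMono_regSum hX) (fun n => (hX.2 0).1.1 n) (fun j n => ht_le_of_lt_regSum hX) hXT
      (hXH.congr fun n => ?_)
    rw [apply_regSum hX.1.1]
    congr 1
    exact (map_sum (AddMonoidHom.mk' (ht l) (ht_add l)) _ _).symm

/-- Properties which hold almost surely from a regeneration time hold almost surely after some time
for transient walks. -/
lemma ae_exists_post_of_regLaw (hP : IID P) (hpos : annealed P (good l) ≠ 0) {p : Path d → Prop}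
    (hp : ∀ᵐ X ∂(regLaw P l), p X) :
    ∀ᵐ X ∂(annealed P), X ∈ transient l → ∃ n, p (post n X) := by
  have hnn : annealed P (nonneg l) ≠ 0 := fun h0 =>
    hpos (measure_mono_null Set.inter_subset_left h0)
  obtain ⟨N, hN, hNm, hN0⟩ := exists_measurable_superset_of_null hp
  rw [regLaw, cond_apply (measurableSet_good l), mul_eq_zero, ENNReal.inv_eq_zero] at hN0
  replace hN0 := hN0.resolve_left (measure_ne_top _ _)
  have h1 : ∀ᵐ X ∂(annealed P), ∀ n, X ∉ strictMax l n ∩ post n ⁻¹' (good l ∩ N) := by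
    rw [ae_all_iff]
    intro n
    rw [← measure_eq_zero_iff_ae_notMem, annealed_strictMax_inter_post hP
      (determinedBy_strictMax l n) le_rfl ((measurableSet_good l).inter hNm) fun X hX => hX.1.1,
      hN0, mul_zero]
  filter_upwards [h1, annealed_exists_regAt hP hnn] with X hX hreg hXt
  obtain ⟨n, -, hn⟩ := hreg hXt
  refine ⟨n, ?_⟩
  by_contra hcon
  exact hX n ⟨hn.1, ⟨hn.2, post_mem_transient.2 hXt⟩, hN hcon⟩

/-- Law of large numbers on the event of transience in direction `l`. -/
theorem annealed_tendsto_of_transient (hP : IID P)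
    (hpos : annealed P (transient l) ≠ 0 → annealed P (good l) ≠ 0) :
    (∃ v : EuclideanSpace ℝ (Fin d), ∀ᵐ X ∂(annealed P), X ∈ transient l →
      Tendsto (fun n : ℕ => (n : ℝ)⁻¹ • toEuclid (X n)) atTop (𝓝 v)) ∨
    ∀ᵐ X ∂(annealed P), X ∈ transient l →
      Tendsto (fun n : ℕ => (n : ℝ)⁻¹ • ht l (X n)) atTop (𝓝 0) := by
  by_cases h0 : annealed P (transient l) = 0
  · right
    filter_upwards [measure_eq_zero_iff_ae_notMem.1 h0] with X hX hX'
    exact absurd hX' hX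
  · rcases regLaw_tendsto hP (hpos h0) with ⟨v, hv⟩ | hv
    · left
      refine ⟨v, ?_⟩
      filter_upwards [ae_exists_post_of_regLaw hP (hpos h0) hv] with X hX hXt
      obtain ⟨m, hm⟩ := hX hXt
      simp only [post, toEuclid_sub] at hm
      exact tendsto_inv_smul_of_shift (x := fun n => toEuclid (X n)) m hm
    · right
      filter_upwards [ae_exists_post_of_regLaw hP (hpos h0) hv] with X hX hXt
      obtain ⟨m, hm⟩ := hX hXt
      simp only [post, ht_sub] at hm
      exact tendsto_inv_smul_of_shift (x := fun n => ht l (X n)) m hm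

end Regeneration

/-! ### The set of possible velocities -/

/-- The trajectory `X` has velocity `u`. -/
def HasVelocity (X : Path d) (u : EuclideanSpace ℝ (Fin d)) : Prop :=
  Tendsto (fun n : ℕ => (n : ℝ)⁻¹ • toEuclid (X n)) atTop (𝓝 u)

lemma HasVelocity.eq {X : Path d} {u v : EuclideanSpace ℝ (Fin d)} (hu : HasVelocity X u)
    (hv : HasVelocity X v) : u = v := tendsto_nhds_unique hu hv

lemma HasVelocity.tendsto_ht {X : Path d} {u : EuclideanSpace ℝ (Fin d)} (hu : HasVelocity X u)
    (l : EuclideanSpace ℝ (Fin d)) :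
    Tendsto (fun n : ℕ => (n : ℝ)⁻¹ • ht l (X n)) atTop (𝓝 (inner ℝ u l)) := by
  have := Tendsto.inner (𝕜 := ℝ) hu (tendsto_const_nhds (x := l))
  simp only [real_inner_smul_left] at this
  exact this

lemma HasVelocity.mem_transient {X : Path d} {u l : EuclideanSpace ℝ (Fin d)}
    (hu : HasVelocity X u) (hl : 0 < inner ℝ u l) : X ∈ transient l := by
  have h := tendsto_natCast_atTop_atTop.atTop_mul_pos hl (hu.tendsto_ht l)
  refine h.congr' ?_
  filter_upwards [eventually_ge_atTop 1] with n hn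
  have hn0 : (n : ℝ) ≠ 0 := by
    have : (0 : ℝ) < n := by exact_mod_cast hn
    exact this.ne'
  rw [smul_eq_mul, mul_inv_cancel_left₀ hn0]

/-- The linear coordinates given by the inner products with a basis. -/
noncomputable def innerCoords (l : Module.Basis (Fin d) ℝ (EuclideanSpace ℝ (Fin d))) :
    EuclideanSpace ℝ (Fin d) ≃L[ℝ] (Fin d → ℝ) :=
  (LinearMap.linearEquivOfInjective
    (LinearMap.pi fun i => (innerₗ (EuclideanSpace ℝ (Fin d))).flip (l i))
    (by
      rw [← LinearMap.ker_eq_bot, LinearMap.ker_eq_bot']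
      intro x hx
      refine InnerProductSpace.ext_inner_right_basis l fun i => ?_
      rw [inner_zero_left]
      exact congrFun hx i)
    (by simp)).toContinuousLinearEquiv

lemma innerCoords_apply (l : Module.Basis (Fin d) ℝ (EuclideanSpace ℝ (Fin d)))
    (x : EuclideanSpace ℝ (Fin d)) (i : Fin d) : innerCoords l x i = inner ℝ x (l i) := rfl

lemma hasVelocity_of_tendsto_ht (l : Module.Basis (Fin d) ℝ (EuclideanSpace ℝ (Fin d)))
    {X : Path d} {c : Fin d → ℝ}
    (h : ∀ i, Tendsto (fun n : ℕ => (n : ℝ)⁻¹ • ht (l i) (X n)) atTop (𝓝 (c i))) :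
    HasVelocity X ((innerCoords l).symm c) := by
  have h1 : Tendsto (fun n : ℕ => innerCoords l ((n : ℝ)⁻¹ • toEuclid (X n))) atTop (𝓝 c) := by
    refine tendsto_pi_nhds.2 fun i => ?_
    simp only [innerCoords_apply, real_inner_smul_left]
    exact h i
  have h2 := ((innerCoords l).symm.continuous.tendsto c).comp h1
  simp only [Function.comp_def, ContinuousLinearEquiv.symm_apply_apply] at h2
  exact h2

lemma eq_neg_smul_of_forall_inner {E : Type*} [NormedAddCommGroup E] [InnerProductSpace ℝ E]
    {u v : E} (hv : v ≠ 0) (hu : u ≠ 0)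
    (h : ∀ l : E, ¬ (0 < inner ℝ v l ∧ 0 < inner ℝ u l)) : ∃ c : ℝ, 0 < c ∧ u = -(c • v) := by
  have hv' := norm_pos_iff.2 hv
  have hu' := norm_pos_iff.2 hu
  have hle : ‖v‖ * ‖u‖ + inner ℝ v u ≤ 0 := by
    by_contra! hcon
    refine h (‖u‖ • v + ‖v‖ • u) ⟨?_, ?_⟩
    · rw [inner_add_right, real_inner_smul_right, real_inner_smul_right,
        real_inner_self_eq_norm_sq]
      have := mul_pos hv' hcon
      linarith
    · rw [inner_add_right, real_inner_smul_right, real_inner_smul_right,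
        real_inner_self_eq_norm_sq, real_inner_comm v u]
      have := mul_pos hu' hcon
      linarith
  refine ⟨‖u‖ / ‖v‖, by positivity, ?_⟩
  have hsq : ‖u + (‖u‖ / ‖v‖) • v‖ ^ 2 ≤ 0 := by
    rw [norm_add_sq_real, norm_smul, real_inner_smul_right, Real.norm_of_nonneg (by positivity),
      div_mul_cancel₀ _ hv'.ne', real_inner_comm v u]
    have : ‖u‖ / ‖v‖ * (‖v‖ * ‖u‖ + inner ℝ v u) ≤ 0 :=
      mul_nonpos_of_nonneg_of_nonpos (by positivity) hle
    have h2 : ‖u‖ / ‖v‖ * (‖v‖ * ‖u‖) = ‖u‖ ^ 2 := by field_simp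
    linarith
  have h0 : ‖u + (‖u‖ / ‖v‖) • v‖ = 0 := by
    have := sq_nonneg ‖u + (‖u‖ / ‖v‖) • v‖
    exact pow_eq_zero_iff two_ne_zero |>.1 (le_antisymm hsq this)
  exact eq_neg_of_add_eq_zero_left (norm_eq_zero.1 h0)

section Velocities

variable {μ : Measure (Path d)}

lemma ae_hasVelocity_of_frequently
    (hμ : ∀ l : EuclideanSpace ℝ (Fin d),
      (∃ v, ∀ᵐ X ∂μ, X ∈ transient l → HasVelocity X v) ∨
      ∀ᵐ X ∂μ, X ∈ transient l → Tendsto (fun n : ℕ => (n : ℝ)⁻¹ • ht l (X n)) atTop (𝓝 0))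
    {u l : EuclideanSpace ℝ (Fin d)} (hu : ∃ᵐ X ∂μ, HasVelocity X u) (hl : 0 < inner ℝ u l) :
    ∀ᵐ X ∂μ, X ∈ transient l → HasVelocity X u := by
  rcases hμ l with ⟨v, hv⟩ | h0
  · obtain ⟨X, hX, hX'⟩ := (hu.and_eventually hv).exists
    rwa [hX.eq (hX' (hX.mem_transient hl))]
  · obtain ⟨X, hX, hX'⟩ := (hu.and_eventually h0).exists
    have := tendsto_nhds_unique (hX.tendsto_ht l) (hX' (hX.mem_transient hl))
    exact absurd this hl.ne'

lemma velocity_unique_of_inner_pos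
    (hμ : ∀ l : EuclideanSpace ℝ (Fin d),
      (∃ v, ∀ᵐ X ∂μ, X ∈ transient l → HasVelocity X v) ∨
      ∀ᵐ X ∂μ, X ∈ transient l → Tendsto (fun n : ℕ => (n : ℝ)⁻¹ • ht l (X n)) atTop (𝓝 0))
    {u v l : EuclideanSpace ℝ (Fin d)} (hu : ∃ᵐ X ∂μ, HasVelocity X u)
    (hv : ∃ᵐ X ∂μ, HasVelocity X v) (hul : 0 < inner ℝ u l) (hvl : 0 < inner ℝ v l) : u = v := by
  obtain ⟨X, hX, hX'⟩ := (hv.and_eventually (ae_hasVelocity_of_frequently hμ hu hul)).exists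
  exact (hX' (hX.mem_transient hvl)).eq hX

/-- Almost surely there is a velocity, and it is one of those with positive probability. -/
lemma ae_exists_velocity
    (hμ : ∀ l : EuclideanSpace ℝ (Fin d),
      (∃ v, ∀ᵐ X ∂μ, X ∈ transient l → HasVelocity X v) ∨
      ∀ᵐ X ∂μ, X ∈ transient l → Tendsto (fun n : ℕ => (n : ℝ)⁻¹ • ht l (X n)) atTop (𝓝 0))
    (l : Module.Basis (Fin d) ℝ (EuclideanSpace ℝ (Fin d)))
    (hl : ∀ i, ∀ᵐ X ∂μ, X ∈ transient (l i) ∨ X ∈ transient (-l i)) :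
    ∀ᵐ X ∂μ, ∃ u, HasVelocity X u ∧ ∃ᵐ Y ∂μ, HasVelocity Y u := by
  have hspeed : ∀ l' : EuclideanSpace ℝ (Fin d), ∃ a : ℝ, ∀ᵐ X ∂μ, X ∈ transient l' →
      Tendsto (fun n : ℕ => (n : ℝ)⁻¹ • ht l' (X n)) atTop (𝓝 a) := by
    intro l'
    rcases hμ l' with ⟨v, hv⟩ | h0
    · refine ⟨inner ℝ v l', ?_⟩
      filter_upwards [hv] with X hX hXt
      exact (hX hXt).tendsto_ht l'
    · exact ⟨0, h0⟩
  choose a ha using hspeed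
  have hneg : ∀ (l' : EuclideanSpace ℝ (Fin d)) z, ht l' z = -ht (-l') z := fun l' z => by
    rw [ht, ht, inner_neg_right, neg_neg]
  let c : (Fin d → Bool) → Fin d → ℝ := fun σ i => if σ i then a (l i) else -a (-l i)
  have hfin : ∀ᵐ X ∂μ, ∃ σ : Fin d → Bool, HasVelocity X ((innerCoords l).symm (c σ)) := by
    filter_upwards [ae_all_iff.2 hl, ae_all_iff.2 fun i => ha (l i),
      ae_all_iff.2 fun i => ha (-l i)] with X h1 h2 h3
    have h4 : ∀ i, ∃ b : Bool, Tendsto (fun n : ℕ => (n : ℝ)⁻¹ • ht (l i) (X n)) atTop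
        (𝓝 (if b then a (l i) else -a (-l i))) := by
      intro i
      rcases h1 i with h | h
      · exact ⟨true, h2 i h⟩
      · refine ⟨false, (h3 i h).neg.congr fun n => ?_⟩
        rw [hneg (l i), smul_neg]
    choose σ hσ using h4
    exact ⟨σ, hasVelocity_of_tendsto_ht l hσ⟩
  have hfreq : ∀ᵐ X ∂μ, ∀ σ : Fin d → Bool, HasVelocity X ((innerCoords l).symm (c σ)) →
      ∃ᵐ Y ∂μ, HasVelocity Y ((innerCoords l).symm (c σ)) := by
    rw [ae_all_iff]
    intro σ
    by_cases h : ∃ᵐ Y ∂μ, HasVelocity Y ((innerCoords l).symm (c σ))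
    · exact ae_of_all _ fun _ _ => h
    · filter_upwards [not_frequently.1 h] with X hX hX'
      exact absurd hX' hX
  filter_upwards [hfin, hfreq] with X ⟨σ, hσ⟩ h
  exact ⟨_, hσ, h σ hσ⟩

/-- At most two velocities, on a common line and in opposite directions, have positive
probability. -/
lemma exists_velocity_pair
    (hμ : ∀ l : EuclideanSpace ℝ (Fin d),
      (∃ v, ∀ᵐ X ∂μ, X ∈ transient l → HasVelocity X v) ∨
      ∀ᵐ X ∂μ, X ∈ transient l → Tendsto (fun n : ℕ => (n : ℝ)⁻¹ • ht l (X n)) atTop (𝓝 0))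
    (l : Module.Basis (Fin d) ℝ (EuclideanSpace ℝ (Fin d)))
    (hl : ∀ i, ∀ᵐ X ∂μ, X ∈ transient (l i) ∨ X ∈ transient (-l i)) :
    ∃ (v : EuclideanSpace ℝ (Fin d)) (c : ℝ), 0 ≤ c ∧
      ∀ u, (∃ᵐ X ∂μ, HasVelocity X u) → u = v ∨ u = -(c • v) := by
  by_cases h0 : ∀ u, (∃ᵐ X ∂μ, HasVelocity X u) → u = 0
  · exact ⟨0, 0, le_rfl, fun u hu => Or.inl (h0 u hu)⟩
  push Not at h0
  obtain ⟨v, hv, hv0⟩ := h0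
  have hopp : ∀ u, (∃ᵐ X ∂μ, HasVelocity X u) → u ≠ v → u ≠ 0 →
      ∃ c : ℝ, 0 < c ∧ u = -(c • v) := fun u hu huv hu0 =>
    eq_neg_smul_of_forall_inner hv0 hu0 fun l' hl' =>
      huv (velocity_unique_of_inner_pos hμ hu hv hl'.2 hl'.1)
  by_cases h1 : ∀ u, (∃ᵐ X ∂μ, HasVelocity X u) → u = v ∨ u = 0
  · exact ⟨v, 0, le_rfl, by simpa using h1⟩
  push Not at h1
  obtain ⟨w, hw, hwv, hw0⟩ := h1
  obtain ⟨c, hc, rfl⟩ := hopp w hw hwv hw0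
  have hvv : 0 < inner ℝ v v := by
    rw [real_inner_self_eq_norm_sq]
    have := norm_pos_iff.2 hv0
    positivity
  refine ⟨v, c, hc.le, fun u hu => ?_⟩
  by_cases huv : u = v
  · exact Or.inl huv
  by_cases hu0 : u = 0
  · exfalso
    subst hu0
    obtain ⟨i, hi⟩ : ∃ i, inner ℝ v (l i) ≠ 0 := by
      by_contra! hcon
      exact hv0 (InnerProductSpace.ext_inner_right_basis l fun i => by rw [hcon i, inner_zero_left])
    obtain ⟨l', hl', htr⟩ : ∃ l' : EuclideanSpace ℝ (Fin d), 0 < inner ℝ v l' ∧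
        ∀ᵐ X ∂μ, X ∈ transient l' ∨ X ∈ transient (-l') := by
      rcases lt_or_gt_of_ne hi with h | h
      · refine ⟨-l i, by rw [inner_neg_right]; linarith, ?_⟩
        rw [neg_neg]
        exact (hl i).mono fun X => Or.symm
      · exact ⟨l i, h, hl i⟩
    have hwl : 0 < inner ℝ (-(c • v)) (-l') := by
      rw [inner_neg_neg, real_inner_smul_left]
      positivity
    obtain ⟨X, hX, h1, h2, h3⟩ := (hu.and_eventually (htr.and
      ((ae_hasVelocity_of_frequently hμ hv hl').and
        (ae_hasVelocity_of_frequently hμ hw hwl)))).exists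
    rcases h1 with h | h
    · exact huv (hX.eq (h2 h))
    · exact hw0 (hX.eq (h3 h)).symm
  · obtain ⟨c', hc', rfl⟩ := hopp u hu huv hu0
    refine Or.inr (velocity_unique_of_inner_pos hμ (l := -v) hu hw ?_ ?_)
    · rw [inner_neg_neg, real_inner_smul_left]
      positivity
    · rw [inner_neg_neg, real_inner_smul_left]
      positivity

end Velocities

/-- Transience in a direction has positive probability only if the walk may stay nonnegative. -/
lemma annealed_good_ne_zero (hd : 1 ≤ d) {P : Measure (Env d)} [IsProbabilityMeasure P]
    (hP : IID P) (hWEL : d = 1 → WEL P) (hEL : 2 ≤ d → EL P) (l : EuclideanSpace ℝ (Fin d))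
    (hl : annealed P (transient l) ≠ 0) : annealed P (good l) ≠ 0 := by
  rcases hd.eq_or_lt with h | h
  · subst h
    exact annealed_nonneg_pos_of_WEL hP (hWEL rfl) hl
  · exact annealed_nonneg_pos_of_EL hP (hEL h) hl

lemma averaged_preimage_snd (P : Measure (Env d)) [IsProbabilityMeasure P] {A : Set (Path d)}
    (hA : MeasurableSet A) : averaged P 0 (Prod.snd ⁻¹' A) = annealed P A := by
  rw [← map_snd_averaged, Measure.map_apply measurable_snd hA]

lemma ae_averaged_of_ae_annealed {P : Measure (Env d)} [IsProbabilityMeasure P] {p : Path d → Prop}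
    (h : ∀ᵐ X ∂(annealed P), p X) : ∀ᵐ q ∂(averaged P 0), p q.2 := by
  rw [← map_snd_averaged] at h
  exact ae_of_ae_map measurable_snd.aemeasurable h

end ERW

theorem mainTheorem11 (d : ℕ) (hd : 1 ≤ d) (P : Measure (ERW.Env d)) [IsProbabilityMeasure P]
    (hIID : ERW.IID P) (hWEL : d = 1 → ERW.WEL P) (hEL : 2 ≤ d → ERW.EL P)
    (l : Module.Basis (Fin d) ℝ (EuclideanSpace ℝ (Fin d)))
    (hl : ∀ i, ERW.averaged P 0 (ERW.transientEvent (l i) ∪ ERW.transientEvent (-l i)) = 1) :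
    (∃ (v : EuclideanSpace ℝ (Fin d)) (c : ℝ), 0 ≤ c ∧
      ∀ᵐ p ∂(ERW.averaged P 0), ∃ u ∈ ({v, -(c • v)} : Set (EuclideanSpace ℝ (Fin d))),
        Tendsto (fun n : ℕ => (n : ℝ)⁻¹ • ERW.toEuclid (p.2 n)) atTop (𝓝 u)) ∧
    ((∀ i, ERW.averaged P 0 (ERW.transientEvent (l i)) = 1) →
      ∃ v : EuclideanSpace ℝ (Fin d), ERW.StrongLLN P v ∧ ∀ i, 0 ≤ inner ℝ v (l i)) := by
  have hdich : ∀ l' : EuclideanSpace ℝ (Fin d),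
      (∃ v, ∀ᵐ X ∂(ERW.annealed P), X ∈ ERW.transient l' → ERW.HasVelocity X v) ∨
      ∀ᵐ X ∂(ERW.annealed P), X ∈ ERW.transient l' →
        Tendsto (fun n : ℕ => (n : ℝ)⁻¹ • ERW.ht l' (X n)) atTop (𝓝 0) := fun l' =>
    ERW.annealed_tendsto_of_transient hIID (ERW.annealed_good_ne_zero hd hIID hWEL hEL l')
  have htr : ∀ i, ∀ᵐ X ∂(ERW.annealed P),
      X ∈ ERW.transient (l i) ∨ X ∈ ERW.transient (-l i) := by
    intro i
    have hm := (ERW.measurableSet_transient (l i)).union (ERW.measurableSet_transient (-l i))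
    refine (mem_ae_iff_prob_eq_one hm).2 ?_
    rw [← ERW.averaged_preimage_snd P hm]
    exact hl i
  have hvel := ERW.ae_exists_velocity hdich l htr
  refine ⟨?_, fun hone => ?_⟩
  · obtain ⟨v, c, hc, hvc⟩ := ERW.exists_velocity_pair hdich l htr
    have hX : ∀ᵐ X ∂(ERW.annealed P), ∃ u ∈ ({v, -(c • v)} : Set (EuclideanSpace ℝ (Fin d))),
        ERW.HasVelocity X u := by
      filter_upwards [hvel] with X ⟨u, hu, hfreq⟩
      exact ⟨u, hvc u hfreq, hu⟩
    exact ⟨v, c, hc, ERW.ae_averaged_of_ae_annealed hX⟩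
  · have hone' : ∀ i, ∀ᵐ X ∂(ERW.annealed P), X ∈ ERW.transient (l i) := by
      intro i
      refine (mem_ae_iff_prob_eq_one (ERW.measurableSet_transient (l i))).2 ?_
      rw [← ERW.averaged_preimage_snd P (ERW.measurableSet_transient (l i))]
      exact hone i
    have hspeed : ∀ i, ∃ a : ℝ, ∀ᵐ X ∂(ERW.annealed P),
        Tendsto (fun n : ℕ => (n : ℝ)⁻¹ • ERW.ht (l i) (X n)) atTop (𝓝 a) := by
      intro i
      rcases hdich (l i) with ⟨v, hv⟩ | h0
      · refine ⟨inner ℝ v (l i), ?_⟩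
        filter_upwards [hv, hone' i] with X hX hXt
        exact (hX hXt).tendsto_ht (l i)
      · refine ⟨0, ?_⟩
        filter_upwards [h0, hone' i] with X hX hXt
        exact hX hXt
    choose a ha using hspeed
    have hv : ∀ᵐ X ∂(ERW.annealed P), ERW.HasVelocity X ((ERW.innerCoords l).symm a) := by
      filter_upwards [ae_all_iff.2 ha] with X hX
      exact ERW.hasVelocity_of_tendsto_ht l hX
    refine ⟨(ERW.innerCoords l).symm a, ERW.ae_averaged_of_ae_annealed hv, fun i => ?_⟩
    obtain ⟨X, hX, hXt⟩ := (hv.and (hone' i)).exists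
    refine ge_of_tendsto (hX.tendsto_ht (l i)) ?_
    filter_upwards [hXt.eventually_ge_atTop 0] with n hn
    exact smul_nonneg (by positivity) hn
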